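/- Let $k>0$, $m>0$, $s>0$ and $r\ge 0$ be real constants. Consider a $(k,r,m,s)$-linear growth model, i.e. a continuous-time Markov chain $\{X_t,t\ge 0\}$ on $\mathbf N=\{0,1,2,\dots\}$ with right-continuous paths and almost surely only finitely many jumps in finite time, started from $x$ under $P^x$, which is the birth-death process with death rates $\alpha_n=kn+r$ ($n\ge 1$) and birth rates $\beta_n=mn+s$ ($n\ge 0$): its transition probabilities $P(t,x,y)=P^x(X_t=y)$ satisfy $\lim_{t\downarrow 0}(P(t,x,y)-\delta_{xy})/t=q_{xy}$, where $q_{n,n+1}=\beta_n$ for $n\ge 0$, $q_{n,n-1}=\alpha_n$ for $n\ge 1$, $q_{00}=-\beta_0$, $q_{nn}=-(\alpha_n+\beta_n)$ for $n\ge 1$, and $q_{xy}=0$ otherwise. Let $\eta_1=\inf\{t>0:X_t\ne X_0\}$ and let $\tau_x=\inf\{t>\eta_1:X_t=x\}$ be the first returning time to $x$ (with $\inf\emptyset=\infty$). The process is called recurrent if $P^x(\tau_x<\infty)=1$ for every $x$, null recurrent if it is recurrent and $E^x(\tau_x)=\infty$ for every $x$, and transient if $P^x(\tau_x<\infty)<1$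 for every $x$. Then: 1. The process is recurrent if and only if $k>m$ or $s-r\le k=m$. 2. The process is null recurrent if and only if $0\le s-r\le k=m$. 3. The process is transient if and only if $k<m$ or $s-r>k=m$. -/

import Mathlib

open Filter Topology MeasureTheory
open scoped NNReal ENNReal

noncomputable section

namespace CTMC

variable {Ω I : Type*}

/-- The successive jump times `η₀ = 0`, `ηₙ₊₁ = inf {t > ηₙ : X_t ≠ X_{ηₙ}}` of the path of `ω`
(with `inf ∅ = ∞`; once some `ηₙ` is infinite, so are all later ones). -/
def jumpTime (X : ℝ≥0 → Ω → I) (ω : Ω) : ℕ → ℝ≥0∞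
  | 0 => 0
  | n + 1 => sInf {T : ℝ≥0∞ | ∃ t : ℝ≥0, T = t ∧ jumpTime X ω n < t ∧
      X t ω ≠ X (jumpTime X ω n).toNNReal ω}

/-- The first returning time `τ_x = inf {t > η₁ : X_t = x}`, with `inf ∅ = ∞`. -/
def returnTime (X : ℝ≥0 → Ω → I) (x : I) (ω : Ω) : ℝ≥0∞ :=
  sInf {T : ℝ≥0∞ | ∃ t : ℝ≥0, T = t ∧ jumpTime X ω 1 < t ∧ X t ω = x}

/-- `X` with the laws `P x` (the law started from `x`) is a continuous-time Markov chain on `I`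
with density matrix `Q`: a right-continuous time-homogeneous Markov process with transition
probabilities `P(t,x,y) = P x (X_t = y)`, whose infinitesimal rates at `t = 0` are the entries
of `Q`, and which almost surely makes only finitely many jumps in finite time. -/
structure IsCTMC [MeasurableSpace Ω] [MeasurableSpace I] [DecidableEq I]
    (Q : Matrix I I ℝ) (P : I → Measure Ω) (X : ℝ≥0 → Ω → I) : Prop where
  isProbabilityMeasure : ∀ x, IsProbabilityMeasure (P x)
  measurable : ∀ t, Measurable (X t)
  right_continuous : ∀ ω t, ∀ᶠ u in 𝓝[>] t, X u ω = X t ω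
  start : ∀ x, P x {ω | X 0 ω = x} = 1
  markov : ∀ (x : I) (s t : ℝ≥0) (A : Set Ω),
    MeasurableSet[⨆ u ≤ s, MeasurableSpace.comap (X u) inferInstance] A →
    ∀ y z : I, P x (A ∩ {ω | X s ω = y} ∩ {ω | X (s + t) ω = z}) =
      P x (A ∩ {ω | X s ω = y}) * P y {ω | X t ω = z}
  rates : ∀ x y : I, Tendsto
    (fun t : ℝ≥0 => ((P x).real {ω | X t ω = y} - (if x = y then 1 else 0)) / (t : ℝ))
    (𝓝[>] 0) (𝓝 (Q x y))
  nonexplosive : ∀ x, ∀ᵐ ω ∂(P x), Tendsto (jumpTime X ω) atTop (𝓝 ∞)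

/-- Recurrence: from every state the chain returns almost surely. -/
def IsRecurrent [MeasurableSpace Ω] (P : I → Measure Ω) (X : ℝ≥0 → Ω → I) : Prop :=
  ∀ x, P x {ω | returnTime X x ω < ∞} = 1

/-- Null recurrence: recurrent, and every mean returning time is infinite. -/
def IsNullRecurrent [MeasurableSpace Ω] (P : I → Measure Ω) (X : ℝ≥0 → Ω → I) : Prop :=
  IsRecurrent P X ∧ ∀ x, ∫⁻ ω, returnTime X x ω ∂(P x) = ∞

/-- Transience: from every state there is a positive probability of never returning. -/
def IsTransient [MeasurableSpace Ω] (P : I → Measure Ω) (X : ℝ≥0 → Ω → I) : Prop :=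
  ∀ x, P x {ω | returnTime X x ω < ∞} < 1

/-- The conservative birth-death density matrix on `ℕ` with death rates `α n` (`n ≥ 1`) and
birth rates `β n` (`n ≥ 0`). There is no death at `0`: the value `α 0` is not used. -/
def birthDeathMatrix (α β : ℕ → ℝ) : Matrix ℕ ℕ ℝ := fun i j =>
  if j = i + 1 then β i
  else if i = j + 1 then α i
  else if i = j then (if i = 0 then -β 0 else -(α i + β i))
  else 0

/-- The `(k,r,m,s)`-linear growth model: the birth-death process with death rates `k n + r` and
birth rates `m n + s`. -/
def IsLinearGrowthModel [MeasurableSpace Ω] (k r m s : ℝ)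
    (P : ℕ → Measure Ω) (X : ℝ≥0 → Ω → ℕ) : Prop :=
  IsCTMC (birthDeathMatrix (fun n => k * n + r) (fun n => m * n + s)) P X

end CTMC

end

/-! Let w_n be the product of α_j/β_j over 1 ≤ j ≤ n (`scaleWeight`) and c_n = 1/(β_n w_n)
(`speedWeight`). For birth-death rates that are positive (except possibly α 0), the chain is
recurrent if ∑ w diverges and transient if it converges. If ∑ c converges, the mean return time to 0
is finite; if both series diverge, every mean return time is infinite. For linear rates the
successive ratios of w and of c are quotients of affine functions of n, so the ratio test decides k
≠ m, and a Raabe-type telescoping decides k = m.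

The criteria rest on Dynkin's inequality: if the generator of f is at most c, the mean of f along
the stopped path is at most its initial value plus c times the mean elapsed time. The test functions
are explicit: the partial sums V of w (harmonic away from 0), ∑ w - V, and `potential`, whose
generator is -1 away from 0. The value at the starting point x is replaced by a separate value a
until the path leaves x, so that a return to x can be told from the start.

Since only the rates at time 0 are given, the inequality is proved for the chain observed at
multiples of h and stopped on returning to x or reaching N (`eventually_integral_value_le`). With f
constant from N on, only finitely many states matter, so one small h makes the error at most ε per
unit time. Right-continuity shows that fine grids detect a return; nonexplosion lets N tend to
infinity. -/

namespace CTMC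

/-! ### Combinatorics of the watched path -/

/-- The path `Y` watched until it has come back to `x` after leaving it, or has reached `N`:
whether it has left `x` already, and its current (or, afterwards, last) position. -/
def track (x N : ℕ) (Y : ℕ → ℕ) : ℕ → Bool × ℕ
  | 0 => (decide (Y 0 ≠ x), Y 0)
  | n + 1 =>
    if (track x N Y n).2 < N ∧ (track x N Y n).1 = decide ((track x N Y n).2 ≠ x) then
      ((track x N Y n).1 || decide (Y (n + 1) ≠ x), Y (n + 1))
    else track x N Y n

/-- The watched path has neither returned to `x` nor reached `N`. -/
def Alive (x N : ℕ) (z : Bool × ℕ) : Prop := z.2 < N ∧ z.1 = decide (z.2 ≠ x)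

instance (x N : ℕ) (z : Bool × ℕ) : Decidable (Alive x N z) := by
  unfold Alive; infer_instance

lemma track_succ (x N : ℕ) (Y : ℕ → ℕ) (n : ℕ) :
    track x N Y (n + 1) = if Alive x N (track x N Y n) then
      ((track x N Y n).1 || decide (Y (n + 1) ≠ x), Y (n + 1)) else track x N Y n := rfl

lemma track_succ_of_alive {x N : ℕ} {Y : ℕ → ℕ} {n : ℕ} (h : Alive x N (track x N Y n)) :
    track x N Y (n + 1) = ((track x N Y n).1 || decide (Y (n + 1) ≠ x), Y (n + 1)) := by
  rw [track_succ, if_pos h]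

lemma track_succ_of_not_alive {x N : ℕ} {Y : ℕ → ℕ} {n : ℕ} (h : ¬ Alive x N (track x N Y n)) :
    track x N Y (n + 1) = track x N Y n := by
  rw [track_succ, if_neg h]

lemma track_snd_of_alive {x N : ℕ} {Y : ℕ → ℕ} {n : ℕ} (h : Alive x N (track x N Y n)) :
    (track x N Y n).2 = Y n := by
  cases n with
  | zero => rfl
  | succ n =>
    by_cases h' : Alive x N (track x N Y n)
    · rw [track_succ_of_alive h']
    · rw [track_succ_of_not_alive h'] at h; exact absurd h h'

lemma alive_of_le {x N : ℕ} {Y : ℕ → ℕ} {i n : ℕ} (hin : i ≤ n)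
    (h : Alive x N (track x N Y n)) : Alive x N (track x N Y i) := by
  induction n, hin using Nat.le_induction with
  | base => exact h
  | succ n _ ih =>
    by_contra h'
    have h2 : ¬ Alive x N (track x N Y n) := fun h3 => h' (ih h3)
    rw [track_succ_of_not_alive h2] at h
    exact h2 h

lemma exists_ne_of_track_fst {x N : ℕ} {Y : ℕ → ℕ} {n : ℕ} (h : (track x N Y n).1 = true) :
    ∃ j ≤ n, Y j ≠ x := by
  induction n with
  | zero => exact ⟨0, le_rfl, by simpa [track] using h⟩
  | succ n ih =>
    by_cases h' : Alive x N (track x N Y n)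
    · rw [track_succ_of_alive h'] at h
      simp only [Bool.or_eq_true, decide_eq_true_eq] at h
      rcases h with h | h
      · obtain ⟨j, hj, hx⟩ := ih h
        exact ⟨j, by omega, hx⟩
      · exact ⟨n + 1, le_rfl, h⟩
    · rw [track_succ_of_not_alive h'] at h
      obtain ⟨j, hj, hx⟩ := ih h
      exact ⟨j, by omega, hx⟩

/-- A watched path which is no longer alive has returned to `x` or has reached `N`. -/
lemma returned_or_large {x N : ℕ} {Y : ℕ → ℕ} {n : ℕ} (h : ¬ Alive x N (track x N Y n)) :
    (track x N Y n = (true, x) ∧ ∃ j i, j < i ∧ i ≤ n ∧ Y j ≠ x ∧ Y i = x) ∨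
    (N ≤ (track x N Y n).2 ∧ ∃ i ≤ n, N ≤ Y i) := by
  induction n with
  | zero =>
    right
    have : N ≤ Y 0 := by
      by_contra h1
      exact h ⟨by simpa [track] using h1, rfl⟩
    exact ⟨this, 0, le_rfl, this⟩
  | succ n ih =>
    by_cases h' : Alive x N (track x N Y n)
    · rw [track_succ_of_alive h'] at h ⊢
      by_cases hN : N ≤ Y (n + 1)
      · exact Or.inr ⟨hN, n + 1, le_rfl, hN⟩
      left
      have h2 : ¬ ((track x N Y n).1 || decide (Y (n + 1) ≠ x)) = decide (Y (n + 1) ≠ x) :=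
        fun h3 => h ⟨not_le.1 hN, h3⟩
      by_cases hx : Y (n + 1) = x
      · have h3 : (track x N Y n).1 = true := by simpa [hx] using h2
        obtain ⟨j, hj, hjx⟩ := exists_ne_of_track_fst h3
        exact ⟨by simp [h3, hx], j, n + 1, by omega, le_rfl, hjx, hx⟩
      · simp [hx] at h2
    · rw [track_succ_of_not_alive h']
      rcases ih h' with ⟨h1, j, i, h2, h3, h4⟩ | ⟨h1, i, h2, h3⟩
      · exact Or.inl ⟨h1, j, i, h2, by omega, h4⟩
      · exact Or.inr ⟨h1, i, by omega, h3⟩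

lemma track_fst_of_ne {x N : ℕ} {Y : ℕ → ℕ} {j n : ℕ} (hjn : j ≤ n) (hj : Y j ≠ x)
    (h : Alive x N (track x N Y n)) : (track x N Y n).1 = true := by
  induction n, hjn using Nat.le_induction with
  | base => rw [h.2, track_snd_of_alive h]; simpa using hj
  | succ n hn ih =>
    have h' := alive_of_le (Nat.le_succ n) h
    rw [track_succ_of_alive h', ih h']
    rfl

/-- A path that has come back to `x` after leaving it is no longer alive. -/
lemma not_alive_of_returned {x N : ℕ} {Y : ℕ → ℕ} {j i n : ℕ} (hji : j < i) (hin : i ≤ n)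
    (hj : Y j ≠ x) (hi : Y i = x) : ¬ Alive x N (track x N Y n) := by
  intro h
  have h' := alive_of_le hin h
  have h1 := track_fst_of_ne hji.le hj h'
  rw [h'.2, track_snd_of_alive h'] at h1
  simp [hi] at h1

lemma track_eq_of_returned {x N : ℕ} {Y : ℕ → ℕ} {j i n : ℕ} (hji : j < i) (hin : i ≤ n)
    (hj : Y j ≠ x) (hi : Y i = x) (hN : ∀ l ≤ i, Y l < N) : track x N Y n = (true, x) := by
  have key : track x N Y i = (true, x) := by
    rcases returned_or_large (not_alive_of_returned hji le_rfl hj hi) with h | ⟨_, l, hl, h⟩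
    · exact h.1
    · exact absurd (hN l hl) (not_lt.2 h)
  induction n, hin using Nat.le_induction with
  | base => exact key
  | succ n hn ih =>
    rw [track_succ_of_not_alive, ih]
    exact not_alive_of_returned hji hn hj hi

/-! ### Return times and grids in continuous time -/

variable {Ω : Type*}

/-- If the path has left `x` and come back, the return time is at most the time of coming back. -/
lemma returnTime_le {X : ℝ≥0 → Ω → ℕ} {x : ℕ} {ω : Ω} {v u : ℝ≥0} (h0 : X 0 ω = x) (hvu : v < u)
    (hv : X v ω ≠ x) (hu : X u ω = x) : returnTime X x ω ≤ u := by
  refine sInf_le ⟨u, rfl, ?_, hu⟩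
  refine lt_of_le_of_lt (b := (v : ℝ≥0∞)) ?_ (by exact_mod_cast hvu)
  refine sInf_le ⟨v, rfl, ?_, ?_⟩
  · have : v ≠ 0 := by rintro rfl; exact hv h0
    simpa [jumpTime] using pos_iff_ne_zero.2 this
  · simpa [jumpTime, h0] using hv

lemma exists_of_returnTime_lt {X : ℝ≥0 → Ω → ℕ} {x : ℕ} {ω : Ω} {T : ℝ≥0∞} (h0 : X 0 ω = x)
    (h : returnTime X x ω < T) :
    ∃ v u : ℝ≥0, v < u ∧ (u : ℝ≥0∞) < T ∧ X v ω ≠ x ∧ X u ω = x := by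
  obtain ⟨_, ⟨u, rfl, hu1, hu⟩, huT⟩ := sInf_lt_iff.1 h
  obtain ⟨_, ⟨v, rfl, -, hv⟩, hvu⟩ := sInf_lt_iff.1 hu1
  refine ⟨v, u, by exact_mod_cast hvu, huT, ?_, hu⟩
  simpa [jumpTime, h0] using hv

lemma exists_grid {a b : ℝ≥0} (hab : a < b) :
    ∀ᶠ h : ℝ≥0 in 𝓝[>] 0, ∃ j : ℕ, a ≤ j * h ∧ j * h < b := by
  have h1 : Set.Ioo (0 : ℝ≥0) (b - a) ∈ 𝓝[>] (0 : ℝ≥0) :=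
    Ioo_mem_nhdsGT (tsub_pos_of_lt hab)
  filter_upwards [h1] with h hh
  refine ⟨⌈a / h⌉₊, ?_, ?_⟩
  · have := Nat.le_ceil (a / h)
    rwa [div_le_iff₀ hh.1] at this
  · have := Nat.ceil_lt_add_one (a := a / h) zero_le
    calc (⌈a / h⌉₊ : ℝ≥0) * h < (a / h + 1) * h := by
          exact mul_lt_mul_of_pos_right this hh.1
      _ = a + h := by rw [add_mul, div_mul_cancel₀ _ hh.1.ne', one_mul]
      _ < b := by
          have := hh.2
          rw [lt_tsub_iff_left] at this
          exact this

/-- A fine enough grid sees that the path leaves `x` and comes back. -/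
lemma grid_return {X : ℝ≥0 → Ω → ℕ} {x : ℕ} {ω : Ω}
    (hc : ∀ t, ∀ᶠ u in 𝓝[>] t, X u ω = X t ω) {v u T : ℝ≥0} (hvu : v < u) (huT : u < T)
    (hv : X v ω ≠ x) (hu : X u ω = x) :
    ∃ b ≤ T, (∀ t, u ≤ t → t < b → X t ω = x) ∧
      ∀ᶠ h : ℝ≥0 in 𝓝[>] 0, ∃ j i : ℕ, j < i ∧ i * h < b ∧
        X (j * h) ω ≠ x ∧ X (i * h) ω = x := by
  have aux : ∀ t w : ℝ≥0, t < w → ∃ b, t < b ∧ b ≤ w ∧ ∀ s, t ≤ s → s < b → X s ω = X t ω := by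
    intro t w htw
    obtain ⟨b, hb, hb'⟩ := (mem_nhdsGT_iff_exists_Ioo_subset' htw).1 (hc t)
    refine ⟨min b w, lt_min hb htw, min_le_right _ _, fun s h1 h2 => ?_⟩
    rcases h1.eq_or_lt with rfl | h1
    · rfl
    · exact hb' ⟨h1, h2.trans_le (min_le_left _ _)⟩
  obtain ⟨b₁, h1, h1', h1''⟩ := aux v u hvu
  obtain ⟨b₂, h2, h2', h2''⟩ := aux u T huT
  refine ⟨b₂, h2', fun t h3 h4 => by rw [h2'' t h3 h4, hu], ?_⟩
  filter_upwards [exists_grid h1, exists_grid h2] with h ⟨j, hj, hj'⟩ ⟨i, hi, hi'⟩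
  refine ⟨j, i, ?_, hi', ?_, ?_⟩
  · have h5 : (j : ℝ≥0) * h < i * h := hj'.trans_le (h1'.trans hi)
    exact_mod_cast lt_of_mul_lt_mul_right h5 zero_le
  · rw [h1'' _ hj hj']; exact hv
  · rw [h2'' _ hi hi', hu]

/-- The path is constant from each jump time up to the next, so it takes finitely many values before
the n-th one. Nonexplosion is used only through the resulting bound on compact time intervals. -/
lemma exists_bound_before_jumpTime (X : ℝ≥0 → Ω → ℕ) (ω : Ω) (n : ℕ) :
    ∃ N, ∀ s : ℝ≥0, (s : ℝ≥0∞) < jumpTime X ω n → X s ω < N := by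
  induction n with
  | zero => exact ⟨0, fun s hs => by simp [jumpTime] at hs⟩
  | succ n ih =>
    obtain ⟨N, hN⟩ := ih
    refine ⟨max N (X (jumpTime X ω n).toNNReal ω + 1), fun s hs => ?_⟩
    by_cases h1 : (s : ℝ≥0∞) < jumpTime X ω n
    · exact lt_max_of_lt_left (hN s h1)
    refine lt_max_of_lt_right (Nat.lt_succ_of_le ?_)
    rcases (not_lt.1 h1).eq_or_lt with h2 | h2
    · rw [h2]; simp
    · refine le_of_eq ?_
      by_contra h3
      have : jumpTime X ω (n + 1) ≤ s := sInf_le ⟨s, rfl, h2, h3⟩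
      exact absurd hs (not_lt.2 this)

lemma exists_bound_of_tendsto_jumpTime {X : ℝ≥0 → Ω → ℕ} {ω : Ω}
    (h : Tendsto (jumpTime X ω) atTop (𝓝 ∞)) (t : ℝ≥0) : ∃ N, ∀ s ≤ t, X s ω < N := by
  obtain ⟨n, hn⟩ := (h.eventually (lt_mem_nhds (ENNReal.coe_lt_top (r := t)))).exists
  obtain ⟨N, hN⟩ := exists_bound_before_jumpTime X ω n
  exact ⟨N, fun s hs => hN s (lt_of_le_of_lt (by exact_mod_cast hs) hn)⟩

end CTMC

/-! ### Generator and Dynkin's inequality on a grid -/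

namespace CTMC

/-- The generator of the birth-death process with death rates `α` and birth rates `β`. -/
def generator (α β : ℕ → ℝ) (f : ℕ → ℝ) (y : ℕ) : ℝ :=
  β y * (f (y + 1) - f y) - α y * (f y - f (y - 1))

/-- Row y is supported in {0, …, N} and sums to zero, so g may be shifted by the constant g N, which
removes the term z = N. -/
lemma sum_birthDeathMatrix (α β g : ℕ → ℝ) {N y : ℕ} (hy : y < N) :
    ∑ z ∈ Finset.range N, (g z - g N) * birthDeathMatrix α β y z = generator α β g y := by
  have h1 : ∑ z ∈ Finset.range N, (g z - g N) * birthDeathMatrix α β y z =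
      ∑ z ∈ Finset.range (N + 1), (g z - g N) * birthDeathMatrix α β y z := by
    rw [Finset.sum_range_succ]; simp
  rw [h1]
  cases y with
  | zero =>
    have h2 : ∀ z ∈ Finset.range (N + 1), (g z - g N) * birthDeathMatrix α β 0 z =
        (if z = 1 then (g z - g N) * β 0 else 0) + (if z = 0 then (g z - g N) * -β 0 else 0) := by
      intro z _
      rcases z with _ | _ | z <;> simp [birthDeathMatrix]
    rw [Finset.sum_congr rfl h2, Finset.sum_add_distrib, Finset.sum_ite_eq', Finset.sum_ite_eq',
      if_pos (by simp; omega), if_pos (by simp)]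
    -- Truncated subtraction, 0 - 1 = 0, makes the death term vanish at 0, whatever α 0 is.
    simp [generator]; ring
  | succ y =>
    have h2 : ∀ z ∈ Finset.range (N + 1), (g z - g N) * birthDeathMatrix α β (y + 1) z =
        (if z = y + 2 then (g z - g N) * β (y + 1) else 0) +
        (if z = y then (g z - g N) * α (y + 1) else 0) +
        (if z = y + 1 then (g z - g N) * -(α (y + 1) + β (y + 1)) else 0) := by
      intro z _
      unfold birthDeathMatrix
      rcases eq_or_ne z (y + 2) with rfl | h3
      · simp
      rcases eq_or_ne z y with rfl | h4
      · simp [show z ≠ z + 1 + 1 by omega]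
      rcases eq_or_ne z (y + 1) with rfl | h5
      · simp
      simp [h3, h4, h5, Ne.symm h4, Ne.symm h5]
    rw [Finset.sum_congr rfl h2, Finset.sum_add_distrib, Finset.sum_add_distrib,
      Finset.sum_ite_eq', Finset.sum_ite_eq', Finset.sum_ite_eq',
      if_pos (by simp; omega), if_pos (by simp; omega), if_pos (by simp; omega)]
    simp [generator]; ring

variable {Ω : Type*}

/-- The value of a watched position: `a` before leaving `x`, and `f y` at `y` later on. -/
def value (a : ℝ) (f : ℕ → ℝ) (z : Bool × ℕ) : ℝ := if z.1 then f z.2 else a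

/-- The path observed at the multiples of `h` and watched by `track`. -/
def gridTrack (X : ℝ≥0 → Ω → ℕ) (x N : ℕ) (h : ℝ≥0) (i : ℕ) (ω : Ω) : Bool × ℕ :=
  track x N (fun j => X (j * h) ω) i

/-- Measurability with respect to the past, not merely the ambient σ-algebra, is what the Markov
property needs. -/
lemma measurable_gridTrack_past (X : ℝ≥0 → Ω → ℕ) (x N : ℕ) (h : ℝ≥0) (i : ℕ) :
    Measurable[⨆ u ≤ (i * h : ℝ≥0), MeasurableSpace.comap (X u) inferInstance]
      (gridTrack X x N h i) := by
  have hXm : ∀ i j : ℕ, j ≤ i → Measurable[⨆ u ≤ (i * h : ℝ≥0),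
      MeasurableSpace.comap (X u) inferInstance] (X (j * h)) := by
    intro i j hji
    refine Measurable.mono (comap_measurable _)
      (le_iSup₂_of_le (f := fun u (_ : u ≤ (i * h : ℝ≥0)) => MeasurableSpace.comap (X u) _)
        (j * h) ?_ le_rfl) le_rfl
    gcongr
  induction i with
  | zero =>
    exact Measurable.comp (g := fun y : ℕ => (decide (y ≠ x), y)) measurable_from_top
      (hXm 0 0 le_rfl)
  | succ i ih =>
    have h1 : gridTrack X x N h (i + 1) = (fun p : (Bool × ℕ) × ℕ => if Alive x N p.1 then
      (p.1.1 || decide (p.2 ≠ x), p.2) else p.1) ∘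
      fun ω => (gridTrack X x N h i ω, X ((i + 1 : ℕ) * h) ω) := rfl
    rw [h1]
    refine Measurable.comp (measurable_of_countable _) (Measurable.prodMk (ih.mono ?_ le_rfl)
      (hXm _ _ le_rfl))
    refine iSup₂_mono' fun u hu => ⟨u, hu.trans ?_, le_rfl⟩
    gcongr
    simp

variable [MeasurableSpace Ω]

lemma exists_bound_of_eventually_const {g : ℕ → ℝ} {N : ℕ} (hg : ∀ z, N ≤ z → g z = g N) :
    ∃ C, ∀ z, |g z| ≤ C := by
  refine ⟨∑ z ∈ Finset.range (N + 1), |g z|, fun z => ?_⟩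
  rcases lt_or_ge z N with h | h
  · exact Finset.single_le_sum (f := fun z => |g z|) (fun _ _ => abs_nonneg _)
      (Finset.mem_range.2 (by omega))
  · rw [hg z h]
    exact Finset.single_le_sum (f := fun z => |g z|) (fun _ _ => abs_nonneg _)
      (Finset.mem_range.2 (by omega))

/-- Such a g is a constant plus finitely many point indicators. Hence the statewise rates and Markov
property extend to g without exchanging a limit and an infinite sum. -/
lemma setIntegral_eventually_const (μ : Measure Ω) [IsFiniteMeasure μ] {g : ℕ → ℝ} {N : ℕ}
    (hg : ∀ z, N ≤ z → g z = g N) (A : Set Ω) {Y : Ω → ℕ} (hY : Measurable Y) :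
    ∫ ω in A, g (Y ω) ∂μ =
      g N * μ.real A + ∑ z ∈ Finset.range N, (g z - g N) * μ.real (A ∩ {ω | Y ω = z}) := by
  have hm : ∀ z, MeasurableSet {ω | Y ω = z} := fun z => hY (measurableSet_singleton z)
  have h1 : ∀ ω, g (Y ω) = g N + ∑ z ∈ Finset.range N,
      Set.indicator {ω | Y ω = z} (fun _ => g z - g N) ω := by
    intro ω
    simp only [Set.indicator_apply, Set.mem_ofPred_eq]
    rw [Finset.sum_ite_eq]
    split_ifs with h
    · ring
    · rw [hg _ (by simpa using h)]; ring
  simp_rw [h1]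
  rw [integral_add (integrable_const _)
    (integrable_finsetSum _ fun z _ => (integrable_const _).indicator (hm z)),
    integral_finsetSum _ fun z _ => (integrable_const _).indicator (hm z)]
  congr 1
  · simp [mul_comm]
  · refine Finset.sum_congr rfl fun z _ => ?_
    rw [integral_indicator (hm z), Measure.restrict_restrict (hm z)]
    simp [mul_comm, Set.inter_comm]

section

variable {P : ℕ → Measure Ω} {X : ℝ≥0 → Ω → ℕ} {α β : ℕ → ℝ}

lemma IsCTMC.tendsto_generator (hX : IsCTMC (birthDeathMatrix α β) P X) {g : ℕ → ℝ} {N y : ℕ}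
    (hg : ∀ z, N ≤ z → g z = g N) (hy : y < N) :
    Tendsto (fun t : ℝ≥0 => (∫ ω, g (X t ω) ∂(P y) - g y) / (t : ℝ)) (𝓝[>] 0)
      (𝓝 (generator α β g y)) := by
  have := hX.isProbabilityMeasure y
  rw [← sum_birthDeathMatrix α β g hy]
  have h1 := tendsto_finsetSum (Finset.range N) fun z _ => (hX.rates y z).const_mul (g z - g N)
  refine h1.congr fun t => ?_
  have h2 := setIntegral_eventually_const (P y) hg Set.univ (hX.measurable t)
  rw [setIntegral_univ] at h2
  simp only [Set.univ_inter, probReal_univ, mul_one] at h2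
  have h3 : ∑ z ∈ Finset.range N, (g z - g N) * (if y = z then (1 : ℝ) else 0) = g y - g N := by
    simp [hy]
  rw [h2]
  simp_rw [mul_div_assoc']
  rw [← Finset.sum_div]
  congr 1
  simp_rw [mul_sub]
  rw [Finset.sum_sub_distrib, h3]
  ring

lemma IsCTMC.setIntegral_markov {Q : Matrix ℕ ℕ ℝ} (hX : IsCTMC Q P X) {g : ℕ → ℝ} {N : ℕ}
    (hg : ∀ z, N ≤ z → g z = g N) (x y : ℕ) (s t : ℝ≥0) {A : Set Ω}
    (hA : MeasurableSet[⨆ u ≤ s, MeasurableSpace.comap (X u) inferInstance] A)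
    (hAy : A ⊆ {ω | X s ω = y}) :
    ∫ ω in A, g (X (s + t) ω) ∂(P x) = (P x).real A * ∫ ω, g (X t ω) ∂(P y) := by
  have := hX.isProbabilityMeasure x
  have := hX.isProbabilityMeasure y
  have h2 := setIntegral_eventually_const (P y) hg Set.univ (hX.measurable t)
  rw [setIntegral_univ] at h2
  rw [setIntegral_eventually_const (P x) hg A (hX.measurable _), h2, mul_add,
    Finset.mul_sum]
  congr 1
  · simp; ring
  · refine Finset.sum_congr rfl fun z _ => ?_
    have h3 := hX.markov x s t A hA y z
    rw [Set.inter_eq_left.2 hAy] at h3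
    simp only [Measure.real, Set.univ_inter]
    rw [h3, ENNReal.toReal_mul]
    ring

lemma IsCTMC.measurable_gridTrack {Q : Matrix ℕ ℕ ℝ} (hX : IsCTMC Q P X) (x N : ℕ) (h : ℝ≥0)
    (i : ℕ) : Measurable (gridTrack X x N h i) :=
  (measurable_gridTrack_past X x N h i).mono
    (iSup₂_le fun u _ => (hX.measurable u).comap_le) le_rfl

lemma measurable_value (a : ℝ) (f : ℕ → ℝ) : Measurable (value a f) := measurable_of_countable _

lemma IsCTMC.integrable_value {Q : Matrix ℕ ℕ ℝ} (hX : IsCTMC Q P X) (a : ℝ) {f : ℕ → ℝ} {N : ℕ}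
    (hf : ∀ z, N ≤ z → f z = f N) (x : ℕ) (h : ℝ≥0) (i : ℕ) :
    Integrable (fun ω => value a f (gridTrack X x N h i ω)) (P x) := by
  have := hX.isProbabilityMeasure x
  obtain ⟨C, hC⟩ := exists_bound_of_eventually_const hf
  refine Integrable.of_bound
    ((measurable_value a f).comp (hX.measurable_gridTrack x N h i)).aestronglyMeasurable
    (max C |a|) (ae_of_all _ fun ω => ?_)
  rw [Real.norm_eq_abs, value]
  split_ifs
  · exact (hC _).trans (le_max_left _ _)
  · exact le_max_right _ _

/-- The event that the path, observed at the multiples of `h`, is still alive at step `i`. -/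
def aliveSet (X : ℝ≥0 → Ω → ℕ) (x N : ℕ) (h : ℝ≥0) (i : ℕ) : Set Ω :=
  {ω | Alive x N (gridTrack X x N h i ω)}

lemma IsCTMC.measurableSet_aliveSet {Q : Matrix ℕ ℕ ℝ} (hX : IsCTMC Q P X) (x N : ℕ) (h : ℝ≥0)
    (i : ℕ) : MeasurableSet (aliveSet X x N h i) :=
  hX.measurable_gridTrack x N h i (Set.to_countable {z | Alive x N z}).measurableSet

/-- The value changes only while the path is alive. Splitting the alive event by the current state
y, the Markov property bounds the mean increment on each piece by c times its probability. -/
lemma IsCTMC.integral_value_succ_le {Q : Matrix ℕ ℕ ℝ} (hX : IsCTMC Q P X) {a c : ℝ} {f : ℕ → ℝ}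
    {x N : ℕ} (hx : x < N) (hf : ∀ z, N ≤ z → f z = f N) {h : ℝ≥0}
    (hgen : ∀ y < N, ∫ ω, (if y = x then Function.update f x a else f) (X h ω) ∂(P y) -
      Function.update f x a y ≤ c) (i : ℕ) :
    ∫ ω, value a f (gridTrack X x N h (i + 1) ω) ∂(P x) ≤
      ∫ ω, value a f (gridTrack X x N h i ω) ∂(P x) + c * (P x).real (aliveSet X x N h i) := by
  have := hX.isProbabilityMeasure x
  -- Scoring of the next position from an alive state y: if y = x the path has not left yet, so
  -- staying at x is worth a; if y ≠ x, a step to x is a return, worth f x.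
  set G : ℕ → ℕ → ℝ := fun y => if y = x then Function.update f x a else f with hG
  have hGN : ∀ y z, N ≤ z → G y z = G y N := by
    intro y z hz
    simp only [hG]
    split_ifs
    · rw [Function.update_of_ne (by omega), Function.update_of_ne (by omega), hf z hz]
    · exact hf z hz
  set E : ℕ → Set Ω := fun y => {ω | gridTrack X x N h i ω = (decide (y ≠ x), y)} with hE
  have hEF : ∀ y, MeasurableSet[⨆ u ≤ (i * h : ℝ≥0),
      MeasurableSpace.comap (X u) inferInstance] (E y) := fun y =>
    measurable_gridTrack_past X x N h i (measurableSet_singleton _)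
  have hEm : ∀ y, MeasurableSet (E y) := fun y =>
    hX.measurable_gridTrack x N h i (measurableSet_singleton _)
  have hEX : ∀ y < N, E y ⊆ {ω | X (i * h) ω = y} := by
    intro y hy ω hω
    have h1 : gridTrack X x N h i ω = (decide (y ≠ x), y) := hω
    have h2 : Alive x N (gridTrack X x N h i ω) := by rw [h1]; exact ⟨hy, rfl⟩
    have h3 := track_snd_of_alive h2
    have h4 : (gridTrack X x N h i ω).2 = X (i * h) ω := h3
    rw [h1] at h4
    exact h4.symm
  have hEmem : ∀ ω y, ω ∈ E y ↔ gridTrack X x N h i ω = (decide (y ≠ x), y) := fun _ _ => Iff.rfl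
  -- For an alive path the flag is determined by the position, so the events E y with y < N
  -- partition the alive event.
  have hpt : ∀ ω, value a f (gridTrack X x N h (i + 1) ω) =
      value a f (gridTrack X x N h i ω) + ∑ y ∈ Finset.range N, (E y).indicator
        (fun ω => G y (X (i * h + h) ω) - Function.update f x a y) ω := by
    intro ω
    by_cases hal : Alive x N (gridTrack X x N h i ω)
    · have h1 : gridTrack X x N h (i + 1) ω = ((gridTrack X x N h i ω).1 ||
          decide (X ((i + 1 : ℕ) * h) ω ≠ x), X ((i + 1 : ℕ) * h) ω) :=
        track_succ_of_alive hal
      have h2 : ((i + 1 : ℕ) * h : ℝ≥0) = i * h + h := by push_cast; ring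
      rw [h2] at h1
      rw [Finset.sum_eq_single (gridTrack X x N h i ω).2]
      · rw [Set.indicator_of_mem]
        · rw [h1]
          have h3 := hal.2
          by_cases h4 : (gridTrack X x N h i ω).2 = x
          · by_cases h5 : X (i * h + h) ω = x
            · simp [value, hG, h3, h4, h5]
            · simp [value, hG, h3, h4, h5]
          · simp [value, hG, h3, h4]
        · rw [hEmem, ← hal.2]
      · intro y _ hy
        rw [Set.indicator_of_notMem]
        rw [hEmem]
        rintro h3
        exact hy (by rw [h3])
      · intro h3
        exact absurd (Finset.mem_range.2 hal.1) h3
    · have h1 : gridTrack X x N h (i + 1) ω = gridTrack X x N h i ω := track_succ_of_not_alive hal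
      rw [h1, Finset.sum_eq_zero, add_zero]
      intro y hy
      rw [Set.indicator_of_notMem]
      intro h3
      rw [hEmem] at h3
      exact hal (by rw [h3]; exact ⟨Finset.mem_range.1 hy, rfl⟩)
  have hint : ∀ y, Integrable (fun ω => G y (X (i * h + h) ω)) (P x) := by
    intro y
    obtain ⟨C, hC⟩ := exists_bound_of_eventually_const (hGN y)
    exact Integrable.of_bound ((measurable_of_countable _).comp
      (hX.measurable _)).aestronglyMeasurable C (ae_of_all _ fun ω => hC _)
  have hint' : ∀ y ∈ Finset.range N, Integrable ((E y).indicator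
      (fun ω => G y (X (i * h + h) ω) - Function.update f x a y)) (P x) := fun y _ =>
    ((hint y).sub (integrable_const _)).indicator (hEm y)
  simp_rw [hpt]
  rw [integral_add (hX.integrable_value a hf x h i) (integrable_finsetSum _ hint'),
    integral_finsetSum _ hint']
  gcongr
  have hsum : (P x).real (aliveSet X x N h i) = ∑ y ∈ Finset.range N, (P x).real (E y) := by
    rw [← measureReal_biUnion_finset _ fun y _ => hEm y]
    · congr 1
      ext ω
      simp only [Set.mem_iUnion, Finset.mem_range, hEmem, exists_prop]
      constructor
      · intro h1
        exact ⟨(gridTrack X x N h i ω).2, h1.1, by rw [← h1.2]⟩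
      · rintro ⟨y, h1, h2⟩
        show Alive x N (gridTrack X x N h i ω)
        rw [h2]; exact ⟨h1, rfl⟩
    · intro y _ y' _ hyy
      refine Set.disjoint_left.2 fun ω h1 h2 => hyy ?_
      rw [hEmem] at h1 h2
      rw [h1] at h2
      exact congrArg Prod.snd h2
  rw [hsum, Finset.mul_sum]
  refine Finset.sum_le_sum fun y hy => ?_
  have hy := Finset.mem_range.1 hy
  rw [integral_indicator (hEm y), integral_sub (hint y).integrableOn (integrable_const _),
    hX.setIntegral_markov (hGN y) x y (i * h) h (hEF y) (hEX y hy)]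
  simp only [integral_const, MeasurableSet.univ, measureReal_restrict_apply, Set.univ_inter,
    smul_eq_mul]
  rw [← mul_sub, mul_comm]
  exact mul_le_mul_of_nonneg_right (hgen y hy) measureReal_nonneg

lemma IsCTMC.ae_start {Q : Matrix ℕ ℕ ℝ} (hX : IsCTMC Q P X) (x : ℕ) :
    ∀ᵐ ω ∂(P x), X 0 ω = x := by
  have := hX.isProbabilityMeasure x
  exact (mem_ae_iff_prob_eq_one (hX.measurable 0 (measurableSet_singleton x))).2 (hX.start x)

/-- Dynkin's inequality for the chain observed at the multiples of `h`. -/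
lemma IsCTMC.eventually_integral_value_le (hX : IsCTMC (birthDeathMatrix α β) P X) {a c : ℝ}
    {f : ℕ → ℝ} {x N : ℕ} (hx : x < N) (hf : ∀ z, N ≤ z → f z = f N)
    (hgen : ∀ y < N, y ≠ x → generator α β f y ≤ c)
    (hgenx : generator α β (Function.update f x a) x ≤ c) {ε : ℝ} (hε : 0 < ε) :
    ∀ᶠ h : ℝ≥0 in 𝓝[>] 0, ∀ n : ℕ, ∫ ω, value a f (gridTrack X x N h n ω) ∂(P x) ≤
      a + (c + ε) * (h * ∑ i ∈ Finset.range n, (P x).real (aliveSet X x N h i)) := by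
  have := hX.isProbabilityMeasure x
  have h1 : ∀ y ∈ Finset.range N, ∀ᶠ h : ℝ≥0 in 𝓝[>] 0,
      ∫ ω, (if y = x then Function.update f x a else f) (X h ω) ∂(P y) -
        Function.update f x a y ≤ (c + ε) * h := by
    intro y hy
    have hy := Finset.mem_range.1 hy
    have h2 : ∀ᶠ h : ℝ≥0 in 𝓝[>] 0,
        (∫ ω, (if y = x then Function.update f x a else f) (X h ω) ∂(P y) -
          Function.update f x a y) / (h : ℝ) < c + ε := by
      by_cases hyx : y = x
      · subst hyx
        simp only [if_true]
        refine (hX.tendsto_generator ?_ hy).eventually_lt_const (by linarith)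
        intro z hz
        rw [Function.update_of_ne (by omega), Function.update_of_ne (by omega), hf z hz]
      · simp only [if_neg hyx, Function.update_of_ne hyx]
        exact (hX.tendsto_generator hf hy).eventually_lt_const (by linarith [hgen y hy hyx])
    filter_upwards [h2, self_mem_nhdsWithin] with h h3 h4
    have h5 : (0 : ℝ) < h := by exact_mod_cast h4
    rw [div_lt_iff₀ h5] at h3
    exact h3.le
  -- Only finitely many y < N occur, so a single range of small h serves them all.
  have h2 := (Filter.eventually_all_finset _).2 h1
  filter_upwards [h2] with h h3 n
  induction n with
  | zero =>
    refine le_of_eq ?_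
    simp only [Finset.range_zero, Finset.sum_empty, mul_zero, add_zero]
    rw [integral_congr_ae (g := fun _ => a)]
    · simp
    · filter_upwards [hX.ae_start x] with ω hω
      simp [gridTrack, track, value, hω]
  | succ n ih =>
    have h4 := hX.integral_value_succ_le hx hf
      (fun y hy => h3 y (Finset.mem_range.2 hy)) n
    rw [Finset.sum_range_succ]
    nlinarith
end

end CTMC

/-! ### Scale and speed weights, explicit test functions -/

namespace CTMC

lemma track_fst_of_snd_ne {x N : ℕ} {Y : ℕ → ℕ} {n : ℕ} (h : (track x N Y n).2 ≠ x) :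
    (track x N Y n).1 = true := by
  induction n with
  | zero => simpa [track] using h
  | succ n ih =>
    by_cases h' : Alive x N (track x N Y n)
    · rw [track_succ_of_alive h'] at h ⊢
      simp [h]
    · rw [track_succ_of_not_alive h'] at h ⊢
      exact ih h

/-- The products `∏_{1 ≤ j ≤ n} α j / β j`: increments of the harmonic function of the
birth-death process. -/
noncomputable def scaleWeight (α β : ℕ → ℝ) (n : ℕ) : ℝ :=
  ∏ j ∈ Finset.range n, α (j + 1) / β (j + 1)

/-- The stationary weights of the birth-death process (up to a constant factor). -/
noncomputable def speedWeight (α β : ℕ → ℝ) (n : ℕ) : ℝ := 1 / (β n * scaleWeight α β n)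

/-- Solutions of `generator f = -1` at the states `y ≥ 1`. -/
noncomputable def potential (α β : ℕ → ℝ) (G : ℝ) (y : ℕ) : ℝ :=
  ∑ i ∈ Finset.range y,
    scaleWeight α β i * (G - ∑ j ∈ Finset.range (i + 1), speedWeight α β j)

section

variable {α β : ℕ → ℝ}

lemma scaleWeight_pos (hα : ∀ n, 0 < α (n + 1)) (hβ : ∀ n, 0 < β n) (n : ℕ) :
    0 < scaleWeight α β n :=
  Finset.prod_pos fun j _ => div_pos (hα j) (hβ _)

lemma speedWeight_pos (hα : ∀ n, 0 < α (n + 1)) (hβ : ∀ n, 0 < β n) (n : ℕ) :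
    0 < speedWeight α β n :=
  one_div_pos.2 (mul_pos (hβ n) (scaleWeight_pos hα hβ n))

/-- The balance relation behind both `generator_sum_scaleWeight` and `generator_potential`. -/
lemma mul_scaleWeight_succ (hβ : ∀ n, 0 < β n) (n : ℕ) :
    β (n + 1) * scaleWeight α β (n + 1) = α (n + 1) * scaleWeight α β n := by
  have := (hβ (n + 1)).ne'
  rw [scaleWeight, Finset.prod_range_succ, ← scaleWeight]
  field_simp

lemma generator_sum_scaleWeight (hβ : ∀ n, 0 < β n) (y : ℕ) :
    generator α β (fun y => ∑ i ∈ Finset.range y, scaleWeight α β i) (y + 1) = 0 := by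
  simp only [generator, Nat.add_sub_cancel]
  rw [Finset.sum_range_succ, Finset.sum_range_succ]
  linear_combination mul_scaleWeight_succ (α := α) hβ y

/-- G is a free parameter because it multiplies the partial sums of w, which are harmonic at
positive states. At state 0 the generator equals -1 only for G = 0. -/
lemma generator_potential (hα : ∀ n, 0 < α (n + 1)) (hβ : ∀ n, 0 < β n) (G : ℝ) (y : ℕ) :
    generator α β (potential α β G) (y + 1) = -1 := by
  simp only [generator, Nat.add_sub_cancel, potential]
  rw [Finset.sum_range_succ _ (y + 1), Finset.sum_range_succ _ y,
    Finset.sum_range_succ _ (y + 1)]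
  have h1 : β (y + 1) * scaleWeight α β (y + 1) * speedWeight α β (y + 1) = 1 := by
    rw [speedWeight]
    exact mul_one_div_cancel (mul_pos (hβ _) (scaleWeight_pos hα hβ _)).ne'
  linear_combination (G - ∑ j ∈ Finset.range (y + 1), speedWeight α β j) *
    mul_scaleWeight_succ (α := α) hβ y - h1

lemma generator_potential_zero (hβ : ∀ n, 0 < β n) :
    generator α β (potential α β 0) 0 = -1 := by
  have := (hβ 0).ne'
  simp [generator, potential, scaleWeight, speedWeight, this]

lemma generator_max {Φ : ℕ → ℝ} {x y : ℕ} (hy : x < y) :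
    generator α β (fun z => Φ (max z x)) y = generator α β Φ y := by
  simp only [generator]
  rw [max_eq_left (by omega), max_eq_left (by omega), max_eq_left (by omega)]

lemma generator_max_of_lt {Φ : ℕ → ℝ} {x y : ℕ} (hy : y < x) :
    generator α β (fun z => Φ (max z x)) y = 0 := by
  simp only [generator]
  rw [max_eq_right (by omega), max_eq_right (by omega), max_eq_right (by omega)]
  ring

lemma generator_min {Φ : ℕ → ℝ} {N y : ℕ} (hy : y < N) :
    generator α β (fun z => Φ (min z N)) y = generator α β Φ y := by
  simp only [generator]
  rw [min_eq_left (by omega), min_eq_left (by omega), min_eq_left (by omega)]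

/-- This vanishes exactly when a is the average of f over the position after the first jump out of
x, which is how a is chosen later. -/
lemma generator_update (f : ℕ → ℝ) (x : ℕ) (a : ℝ) :
    generator α β (Function.update f x a) x =
      β x * f (x + 1) + (if x = 0 then 0 else α x) * f (x - 1) -
        (β x + if x = 0 then 0 else α x) * a := by
  rcases x with _ | x
  · simp [generator]; ring
  · simp [generator]; ring

lemma generator_const_add (f : ℕ → ℝ) (b : ℝ) (y : ℕ) :
    generator α β (fun z => b + f z) y = generator α β f y := by
  simp only [generator]; ring

lemma generator_neg (f : ℕ → ℝ) (y : ℕ) :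
    generator α β (fun z => - f z) y = - generator α β f y := by
  simp only [generator]; ring

lemma exitRate_pos (hα : ∀ n, 0 < α (n + 1)) (hβ : ∀ n, 0 < β n) (x : ℕ) :
    0 < β x + if x = 0 then 0 else α x := by
  rcases x with _ | x
  · simpa using hβ 0
  · have := hβ (x + 1); have := hα x
    simp; positivity

end

/-! ### Exit times, recurrence and transience criteria -/

variable {Ω : Type*}

lemma aliveSet_antitone (X : ℝ≥0 → Ω → ℕ) (x N : ℕ) (h : ℝ≥0) : Antitone (aliveSet X x N h) :=
  fun _ _ hij _ hω => alive_of_le hij hω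

variable [MeasurableSpace Ω] {P : ℕ → Measure Ω} {X : ℝ≥0 → Ω → ℕ} {α β : ℕ → ℝ}

lemma IsCTMC.eventually_integral_value_min_le (hX : IsCTMC (birthDeathMatrix α β) P X) {a c : ℝ}
    {f : ℕ → ℝ} {x N : ℕ} (hx : x < N)
    (hgen : ∀ y < N, y ≠ x → generator α β f y ≤ c)
    (hgenx : generator α β (Function.update f x a) x ≤ c) {ε : ℝ} (hε : 0 < ε) :
    ∀ᶠ h : ℝ≥0 in 𝓝[>] 0, ∀ n : ℕ,
      ∫ ω, value a (fun z => f (min z N)) (gridTrack X x N h n ω) ∂(P x) ≤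
        a + (c + ε) * (h * ∑ i ∈ Finset.range n, (P x).real (aliveSet X x N h i)) := by
  refine hX.eventually_integral_value_le hx (fun z hz => by simp [hz])
    (fun y hy hyx => ?_) ?_ hε
  · rw [generator_min hy]; exact hgen y hy hyx
  · refine le_of_eq_of_le ?_ hgenx
    rw [generator_update, generator_update, min_eq_left (by omega), min_eq_left (by omega)]

lemma IsCTMC.integrable_value_min {Q : Matrix ℕ ℕ ℝ} (hX : IsCTMC Q P X) (a : ℝ) (f : ℕ → ℝ)
    (N x : ℕ) (h : ℝ≥0) (i : ℕ) :
    Integrable (fun ω => value a (fun z => f (min z N)) (gridTrack X x N h i ω)) (P x) :=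
  hX.integrable_value a (fun z hz => by simp [hz]) x h i

/-- The mean time until a return to `x` or the passage to `N` is finite. -/
lemma IsCTMC.exists_exitTime_le (hX : IsCTMC (birthDeathMatrix α β) P X)
    (hα : ∀ n, 0 < α (n + 1)) (hβ : ∀ n, 0 < β n) {x N : ℕ} (hx : x < N) :
    ∃ C, 0 ≤ C ∧ ∀ᶠ h : ℝ≥0 in 𝓝[>] 0, ∀ n : ℕ,
      h * ∑ i ∈ Finset.range n, (P x).real (aliveSet X x N h i) ≤ C := by
  have := hX.isProbabilityMeasure x
  set F := potential α β 0 with hF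
  have hanti : Antitone F := by
    refine antitone_nat_of_succ_le fun n => ?_
    rw [hF, potential, Finset.sum_range_succ, ← potential]
    have h1 : 0 ≤ ∑ j ∈ Finset.range (n + 1), speedWeight α β j :=
      Finset.sum_nonneg fun j _ => (speedWeight_pos hα hβ j).le
    have h2 := mul_nonneg (scaleWeight_pos hα hβ n).le h1
    linarith
  have hgen : ∀ y, generator α β F y ≤ -1 := by
    rintro (_ | y)
    · exact (generator_potential_zero hβ).le
    · exact (generator_potential hα hβ 0 y).le
  -- With ε = 1/2 the drift is at most -1/2, so F N ≤ F x - time/2. Taking a = F x makes the special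
  -- value at x invisible.
  refine ⟨2 * (F x - F N), by linarith [hanti hx.le], ?_⟩
  filter_upwards [hX.eventually_integral_value_min_le (a := F x) hx (fun y _ _ => hgen y)
    (by rw [Function.update_eq_self]; exact hgen x) (ε := 1 / 2) (by norm_num)] with h hh n
  have h1 := hh n
  have h2 : F N ≤ ∫ ω, value (F x) (fun z => F (min z N)) (gridTrack X x N h n ω) ∂(P x) := by
    have h3 := integral_mono (μ := P x) (integrable_const (F N))
      (hX.integrable_value_min (F x) F N x h n) fun ω => by
        simp only [value]
        split_ifs
        · exact hanti (min_le_right _ _)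
        · exact hanti hx.le
    simpa using h3
  linarith

/-- The alive events decrease in time, so a bound on the mean exit time makes survival up to time n
h unlikely. -/
lemma IsCTMC.nat_mul_measure_aliveSet_le {Q : Matrix ℕ ℕ ℝ} (hX : IsCTMC Q P X) (x N : ℕ)
    (h : ℝ≥0) (n : ℕ) : n * h * (P x).real (aliveSet X x N h n) ≤
      h * ∑ i ∈ Finset.range n, (P x).real (aliveSet X x N h i) := by
  have := hX.isProbabilityMeasure x
  have h1 : ∑ i ∈ Finset.range n, (P x).real (aliveSet X x N h n) ≤
      ∑ i ∈ Finset.range n, (P x).real (aliveSet X x N h i) :=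
    Finset.sum_le_sum fun i hi => measureReal_mono
      (aliveSet_antitone X x N h (Finset.mem_range.1 hi).le)
  rw [Finset.sum_const, Finset.card_range, nsmul_eq_mul] at h1
  calc n * h * (P x).real (aliveSet X x N h n) = h * (n * (P x).real (aliveSet X x N h n)) := by
        ring
    _ ≤ _ := mul_le_mul_of_nonneg_left h1 h.2

/-- F, which is V - V x above x and 0 below, is nonnegative and harmonic off x, and its mean starts
at a. So reaching N before returning has probability about a / F N at most, and F N tends to
infinity. -/
theorem IsCTMC.isRecurrent (hX : IsCTMC (birthDeathMatrix α β) P X)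
    (hα : ∀ n, 0 < α (n + 1)) (hβ : ∀ n, 0 < β n) (hw : ¬ Summable (scaleWeight α β)) :
    IsRecurrent P X := by
  intro x
  have := hX.isProbabilityMeasure x
  set V : ℕ → ℝ := fun y => ∑ i ∈ Finset.range y, scaleWeight α β i with hV
  have hVmono : Monotone V := by
    refine monotone_nat_of_le_succ fun n => ?_
    simp only [hV]
    rw [Finset.sum_range_succ]
    linarith [scaleWeight_pos hα hβ n]
  have hVtop : Tendsto V atTop atTop :=
    (not_summable_iff_tendsto_nat_atTop_of_nonneg fun n => (scaleWeight_pos hα hβ n).le).1 hw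
  set F : ℕ → ℝ := fun y => -V x + V (max y x) with hF
  have hF0 : ∀ y, 0 ≤ F y := fun y => by
    have := hVmono (le_max_right y x)
    simp only [hF]; linarith
  set q := β x + if x = 0 then 0 else α x with hq
  have hq0 : 0 < q := exitRate_pos hα hβ x
  set a := (β x * F (x + 1) + (if x = 0 then 0 else α x) * F (x - 1)) / q with ha
  have hgen : ∀ y, y ≠ x → generator α β F y ≤ 0 := by
    intro y hy
    rw [hF, generator_const_add]
    rcases lt_or_gt_of_ne hy with h | h
    · rw [generator_max_of_lt h]
    · rw [generator_max h]
      obtain ⟨y, rfl⟩ := Nat.exists_eq_succ_of_ne_zero (Nat.ne_zero_of_lt h)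
      exact (generator_sum_scaleWeight hβ y).le
  have hgenx : generator α β (Function.update F x a) x ≤ 0 := by
    rw [generator_update, ← hq, ha, mul_div_cancel₀ _ hq0.ne', sub_self]
  have ha0 : 0 ≤ a := by
    refine div_nonneg (add_nonneg (mul_nonneg (hβ x).le (hF0 _)) (mul_nonneg ?_ (hF0 _))) hq0.le
    rcases x with _ | x
    · simp
    · simpa using (hα x).le
  suffices h : 1 ≤ (P x).real {ω | returnTime X x ω < ∞} by
    refine le_antisymm prob_le_one ?_
    rw [Measure.real] at h
    exact (ENNReal.ofReal_one ▸ ENNReal.ofReal_le_ofReal h).trans ENNReal.ofReal_toReal_le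
  refine le_of_forall_pos_le_add fun δ hδ => ?_
  have hFtop : Tendsto F atTop atTop := by
    refine tendsto_atTop_add_const_left _ _ (hVtop.comp ?_)
    exact tendsto_atTop_mono (fun n => le_max_left n x) tendsto_id
  obtain ⟨N, hFN, hN⟩ := ((hFtop.eventually_ge_atTop ((a + 1) / (δ / 2))).and
    (eventually_gt_atTop x)).exists
  obtain ⟨C, hC0, hC⟩ := hX.exists_exitTime_le hα hβ hN
  -- The total Dynkin error, ε times a mean time of at most C, is then at most 1; hence a + 1 in the
  -- choice of N.
  have hε : 0 < 1 / (C + 1) := by positivity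
  obtain ⟨h, ⟨hh1, hh2⟩, hh3⟩ := ((hC.and (hX.eventually_integral_value_min_le hN
    (fun y _ hy => hgen y hy) hgenx hε)).and self_mem_nhdsWithin).exists
  have hh3 : (0 : ℝ) < h := by exact_mod_cast hh3
  obtain ⟨n, hn⟩ := exists_nat_gt (C / (δ / 2) / h)
  have halive : (P x).real (aliveSet X x N h n) ≤ δ / 2 := by
    have h1 := (hX.nat_mul_measure_aliveSet_le x N h n).trans (hh1 n)
    rw [div_lt_iff₀ hh3, div_lt_iff₀ (by positivity)] at hn
    by_contra h2
    have h3 : (0 : ℝ) ≤ n * h := by positivity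
    nlinarith
  set B : Set Ω := {ω | N ≤ (gridTrack X x N h n ω).2} with hB
  have hBm : MeasurableSet B := hX.measurable_gridTrack x N h n
    (Set.to_countable {z : Bool × ℕ | N ≤ z.2}).measurableSet
  have hlarge : (P x).real B ≤ δ / 2 := by
    have h1 : (P x).real B * F N ≤
        ∫ ω, value a (fun z => F (min z N)) (gridTrack X x N h n ω) ∂(P x) := by
      have h2 : ∫ ω, B.indicator (fun _ => F N) ω ∂(P x) = (P x).real B * F N := by
        rw [integral_indicator_const _ hBm, smul_eq_mul]
      rw [← h2]
      refine integral_mono ((integrable_const _).indicator hBm)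
        (hX.integrable_value_min a F N x h n) fun ω => ?_
      by_cases hω : ω ∈ B
      · rw [Set.indicator_of_mem hω]
        have h3 : N ≤ (gridTrack X x N h n ω).2 := hω
        have h4 : (gridTrack X x N h n ω).1 = true := track_fst_of_snd_ne (by
          change (gridTrack X x N h n ω).2 ≠ x
          omega)
        simp [value, h4, h3]
      · rw [Set.indicator_of_notMem hω]
        simp only [value]
        split_ifs
        exacts [hF0 _, ha0]
    have h5 := h1.trans (hh2 n)
    have h6 : (0 + 1 / (C + 1)) * (h * ∑ i ∈ Finset.range n, (P x).real (aliveSet X x N h i))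
        ≤ 1 := by
      rw [zero_add, one_div, inv_mul_le_iff₀ (by positivity)]
      linarith [hh1 n]
    have h7 : 0 < F N := lt_of_lt_of_le (by positivity) hFN
    rw [div_le_iff₀ (by positivity)] at hFN
    by_contra h8
    nlinarith
  -- A return seen on the grid is a genuine return, so no path regularity enters. Only subadditivity
  -- is used, so the return event need not be measurable.
  have hcover : (P x).real Set.univ ≤ (P x).real
      ({ω | returnTime X x ω < ∞} ∪ (aliveSet X x N h n ∪ B)) := by
    refine ENNReal.toReal_mono (measure_ne_top _ _) (measure_mono_ae ?_)
    filter_upwards [hX.ae_start x] with ω hω _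
    by_cases h1 : Alive x N (gridTrack X x N h n ω)
    · exact Or.inr (Or.inl h1)
    rcases returned_or_large h1 with ⟨_, j, i, hji, _, hj, hi⟩ | ⟨h2, _⟩
    · left
      refine lt_of_le_of_lt (returnTime_le hω ?_ hj hi) ENNReal.coe_lt_top
      exact mul_lt_mul_of_pos_right (by exact_mod_cast hji) (by exact_mod_cast hh3)
    · exact Or.inr (Or.inr h2)
  rw [probReal_univ] at hcover
  have h1 := measureReal_union_le (μ := P x) {ω | returnTime X x ω < ∞} (aliveSet X x N h n ∪ B)
  have h2 := measureReal_union_le (μ := P x) (aliveSet X x N h n) B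
  linarith

/-- Continuity from below along the increasing tail intersections of D, valid for arbitrary sets. -/
lemma measure_le_of_ae_eventually_mem {μ : Measure Ω} {E : Set Ω} {D : ℕ → Set Ω} {c : ℝ≥0∞}
    (hE : ∀ᵐ ω ∂μ, ω ∈ E → ∀ᶠ n in atTop, ω ∈ D n) (hD : ∀ᶠ n in atTop, μ (D n) ≤ c) :
    μ E ≤ c := by
  have h1 : μ E ≤ μ (⋃ m, ⋂ n ≥ m, D n) := by
    refine measure_mono_ae ?_
    filter_upwards [hE] with ω hω hωE
    obtain ⟨m, hm⟩ := eventually_atTop.1 (hω hωE)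
    exact Set.mem_iUnion.2 ⟨m, Set.mem_iInter₂.2 hm⟩
  refine h1.trans ?_
  have hmono : Monotone fun m => ⋂ n ≥ m, D n := fun m m' hmm ω hω =>
    Set.mem_iInter₂.2 fun n hn => Set.mem_iInter₂.1 hω n (le_trans hmm hn)
  rw [hmono.measure_iUnion]
  refine iSup_le fun m => ?_
  obtain ⟨n, hn, hmn⟩ := (hD.and (eventually_ge_atTop m)).exists
  exact (measure_mono (Set.biInter_subset_of_mem hmn)).trans hn

lemma tendsto_div_nat {t : ℝ≥0} (ht : 0 < t) :
    Tendsto (fun n : ℕ => t / n) atTop (𝓝[>] 0) := by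
  refine tendsto_nhdsWithin_iff.2 ⟨?_, ?_⟩
  · rw [← NNReal.tendsto_coe]
    simpa using tendsto_const_div_atTop_nhds_zero_nat (t : ℝ)
  · filter_upwards [eventually_gt_atTop 0] with n hn
    exact div_pos ht (by exact_mod_cast hn)

/-- F, which is ∑ w - V above x and constant below, is positive and harmonic off x. The first jump
lowers its mean to a < F x, while a return yields F x, so returning has probability at most a / F x
up to error. -/
theorem IsCTMC.isTransient (hX : IsCTMC (birthDeathMatrix α β) P X)
    (hα : ∀ n, 0 < α (n + 1)) (hβ : ∀ n, 0 < β n) (hw : Summable (scaleWeight α β)) :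
    IsTransient P X := by
  intro x
  have := hX.isProbabilityMeasure x
  set S := ∑' i, scaleWeight α β i with hS
  set V : ℕ → ℝ := fun y => ∑ i ∈ Finset.range y, scaleWeight α β i with hV
  have hVS : ∀ y, V y < S := fun y => by
    have h1 := hw.sum_le_tsum (Finset.range (y + 1)) fun i _ => (scaleWeight_pos hα hβ i).le
    rw [Finset.sum_range_succ] at h1
    have h2 := scaleWeight_pos hα hβ y
    simp only [hV]; linarith
  set F : ℕ → ℝ := fun y => S + -V (max y x) with hF
  have hF0 : ∀ y, 0 ≤ F y := fun y => by
    have := hVS (max y x)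
    simp only [hF]; linarith
  set q := β x + if x = 0 then 0 else α x with hq
  have hq0 : 0 < q := exitRate_pos hα hβ x
  set a := (β x * F (x + 1) + (if x = 0 then 0 else α x) * F (x - 1)) / q with ha
  have hgen : ∀ y, y ≠ x → generator α β F y ≤ 0 := by
    intro y hy
    rw [hF, generator_const_add, generator_neg]
    rcases lt_or_gt_of_ne hy with h | h
    · rw [generator_max_of_lt h, neg_zero]
    · rw [generator_max h]
      obtain ⟨y, rfl⟩ := Nat.exists_eq_succ_of_ne_zero (Nat.ne_zero_of_lt h)
      rw [generator_sum_scaleWeight hβ y, neg_zero]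
  have hgenx : generator α β (Function.update F x a) x ≤ 0 := by
    rw [generator_update, ← hq, ha, mul_div_cancel₀ _ hq0.ne', sub_self]
  have hd0 : 0 ≤ if x = 0 then 0 else α x := by
    rcases x with _ | x
    · simp
    · simpa using (hα x).le
  have ha0 : 0 ≤ a :=
    div_nonneg (add_nonneg (mul_nonneg (hβ x).le (hF0 _)) (mul_nonneg hd0 (hF0 _))) hq0.le
  have hFx : 0 < F x := by
    have := hVS x
    simp only [hF, max_self]; linarith
  have haF : a < F x := by
    rw [ha, div_lt_iff₀ hq0]
    have h1 : F (x + 1) = F x - scaleWeight α β x := by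
      simp only [hF, hV, max_self]
      rw [max_eq_left (by omega), Finset.sum_range_succ]
      ring
    have h2 : F (x - 1) = F x := by
      simp only [hF]
      rw [max_self, max_eq_right (by omega)]
    rw [h1, h2, hq]
    have := mul_pos (hβ x) (scaleWeight_pos hα hβ x)
    linarith
  -- The midpoint of a and F x leaves room (F x - a)/2 for the Dynkin error.
  set κ := (a + F x) / 2 / F x with hκ
  have hκ1 : κ < 1 := by rw [hκ, div_lt_one hFx]; linarith
  refine lt_of_le_of_lt (b := ENNReal.ofReal κ) ?_ (by
    rw [← ENNReal.ofReal_one]; exact (ENNReal.ofReal_lt_ofReal_iff one_pos).2 hκ1)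
  -- N serves both as height bound and as time horizon; by nonexplosion almost every returning path
  -- meets both for large N.
  refine measure_le_of_ae_eventually_mem (D := fun N => {ω | ∃ v u : ℝ≥0, v < u ∧ u < N ∧
    X v ω ≠ x ∧ X u ω = x ∧ ∀ s ≤ u, X s ω < N}) ?_ ?_
  · filter_upwards [hX.ae_start x, hX.nonexplosive x] with ω h0 hexp hτ
    obtain ⟨v, u, hvu, _, hv, hu⟩ := exists_of_returnTime_lt h0 hτ
    obtain ⟨N, hN⟩ := exists_bound_of_tendsto_jumpTime hexp u
    obtain ⟨M, hM⟩ := exists_nat_gt u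
    filter_upwards [eventually_ge_atTop N, eventually_ge_atTop M] with K hK1 hK2
    exact ⟨v, u, hvu, hM.trans_le (by exact_mod_cast hK2), hv, hu,
      fun s hs => (hN s hs).trans_le hK1⟩
  filter_upwards [eventually_gt_atTop x] with N hN
  have hN0 : (0 : ℝ≥0) < N := by exact_mod_cast (Nat.zero_le x).trans_lt hN
  have hN0' : (0 : ℝ) < N := by exact_mod_cast hN0
  refine measure_le_of_ae_eventually_mem
    (D := fun n => {ω | gridTrack X x N (N / n) n ω = (true, x)}) (ae_of_all _ ?_) ?_
  · rintro ω ⟨v, u, hvu, huN, hv, hu, hb⟩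
    obtain ⟨b, hbN, hub, hgrid⟩ := grid_return (hX.right_continuous ω) hvu huN hv hu
    filter_upwards [(tendsto_div_nat hN0).eventually hgrid, eventually_gt_atTop 0]
      with n ⟨j, i, hji, hib, hj, hi⟩ hn
    have hn' : (0 : ℝ≥0) < n := by exact_mod_cast hn
    refine track_eq_of_returned hji ?_ hj hi ?_
    · have h1 : (i : ℝ≥0) * (N / n) < n * (N / n) := by
        rw [mul_div_cancel₀ _ hn'.ne']
        exact hib.trans_le hbN
      exact_mod_cast (lt_of_mul_lt_mul_right h1 zero_le).le
    · intro l hl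
      have h1 : (l : ℝ≥0) * (N / n) ≤ i * (N / n) := by gcongr
      -- A grid time beyond u still lies in [u, b), where the path sits at x < N.
      rcases le_or_gt (l * (N / n) : ℝ≥0) u with h2 | h2
      · exact hb _ h2
      · change X (l * (N / n)) ω < N
        rw [hub _ h2.le (h1.trans_lt hib)]
        exact hN
  have hε : 0 < (F x - a) / 2 / N := by
    have : 0 < F x - a := by linarith
    positivity
  filter_upwards [(tendsto_div_nat hN0).eventually (hX.eventually_integral_value_min_le hN
    (fun y _ hy => hgen y hy) hgenx hε), eventually_gt_atTop 0] with n hn hn0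
  have hn0' : (0 : ℝ) < n := by exact_mod_cast hn0
  set D : Set Ω := {ω | gridTrack X x N (N / n) n ω = (true, x)} with hD
  have hDm : MeasurableSet D := hX.measurable_gridTrack x N _ n (measurableSet_singleton _)
  have h1 : (P x).real D * F x ≤
      ∫ ω, value a (fun z => F (min z N)) (gridTrack X x N (N / n) n ω) ∂(P x) := by
    have h2 : ∫ ω, D.indicator (fun _ => F x) ω ∂(P x) = (P x).real D * F x := by
      rw [integral_indicator_const _ hDm, smul_eq_mul]
    rw [← h2]
    refine integral_mono ((integrable_const _).indicator hDm)
      (hX.integrable_value_min a F N x _ n) fun ω => ?_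
    by_cases hω : ω ∈ D
    · rw [Set.indicator_of_mem hω]
      have h3 : gridTrack X x N (N / n) n ω = (true, x) := hω
      simp [value, h3, hN.le]
    · rw [Set.indicator_of_notMem hω]
      simp only [value]
      split_ifs
      exacts [hF0 _, ha0]
  have h4 := h1.trans (hn n)
  have h5 : ∑ i ∈ Finset.range n, (P x).real (aliveSet X x N (N / n) i) ≤ n := by
    refine (Finset.sum_le_sum fun i _ => measureReal_le_one).trans ?_
    simp
  have h6 : ((N / n : ℝ≥0) : ℝ) * ∑ i ∈ Finset.range n, (P x).real (aliveSet X x N (N / n) i)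
      ≤ N := by
    refine (mul_le_mul_of_nonneg_left h5 (NNReal.coe_nonneg _)).trans (le_of_eq ?_)
    push_cast
    field_simp
  have h7 : (0 + (F x - a) / 2 / N) * (((N / n : ℝ≥0) : ℝ) *
      ∑ i ∈ Finset.range n, (P x).real (aliveSet X x N (N / n) i)) ≤ (F x - a) / 2 := by
    rw [zero_add]
    refine (mul_le_mul_of_nonneg_left h6 hε.le).trans (le_of_eq ?_)
    field_simp
  have h8 : (P x).real D ≤ κ := by
    rw [hκ, le_div_iff₀ hFx]; linarith
  rw [Measure.real] at h8
  exact (ENNReal.le_ofReal_iff_toReal_le (measure_ne_top _ _)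
    (ENNReal.toReal_nonneg.trans h8)).2 h8

end CTMC

/-! ### Mean return times -/

namespace CTMC

variable {Ω : Type*}

/-- The time spent alive by the chain observed at the first `n` multiples of `h`. -/
noncomputable def gridTime (X : ℝ≥0 → Ω → ℕ) (x N : ℕ) (h : ℝ≥0) (n : ℕ) (ω : Ω) : ℝ≥0∞ :=
  ∑ i ∈ Finset.range n, (aliveSet X x N h i).indicator (fun _ => (h : ℝ≥0∞)) ω

lemma gridTime_le (X : ℝ≥0 → Ω → ℕ) (x N : ℕ) (h : ℝ≥0) (n : ℕ) (ω : Ω) :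
    gridTime X x N h n ω ≤ (n * h : ℝ≥0) := by
  refine (Finset.sum_le_sum fun i _ => Set.indicator_le_self' (fun _ _ => zero_le) ω).trans ?_
  simp

lemma gridTime_le_of_not_alive {X : ℝ≥0 → Ω → ℕ} {x N : ℕ} {h : ℝ≥0} {i : ℕ} {ω : Ω}
    (hi : ω ∉ aliveSet X x N h i) (n : ℕ) : gridTime X x N h n ω ≤ (i * h : ℝ≥0) := by
  rcases le_total n i with hn | hn
  · refine (gridTime_le X x N h n ω).trans ?_
    gcongr
  · refine le_trans (le_of_eq ?_) (gridTime_le X x N h i ω)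
    symm
    refine Finset.sum_subset (by simpa using hn) fun l _ hl => ?_
    rw [Set.indicator_of_notMem]
    exact fun h' => hi (aliveSet_antitone X x N h (by simpa using hl) h')

/-- Before the true return, a path below N is alive at every grid time, and each such time
contributes h. A coarse grid may miss the return, so only this inequality holds for every h. -/
lemma min_le_gridTime {X : ℝ≥0 → Ω → ℕ} {x N : ℕ} {h : ℝ≥0} {ω : Ω} (h0 : X 0 ω = x) (hh : 0 < h)
    (n : ℕ) (hN : ∀ s ≤ n * h, X s ω < N) :
    min (returnTime X x ω) ((n * h : ℝ≥0) : ℝ≥0∞) ≤ gridTime X x N h n ω := by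
  induction n with
  | zero => simp
  | succ n ih =>
    have ih := ih fun s hs => hN s (hs.trans (by gcongr; simp))
    rw [gridTime, Finset.sum_range_succ, ← gridTime]
    rcases le_or_gt (returnTime X x ω) ((n * h : ℝ≥0) : ℝ≥0∞) with h1 | h1
    · rw [min_eq_left h1] at ih
      exact (min_le_left _ _).trans (ih.trans le_self_add)
    · rw [min_eq_right h1.le] at ih
      have h2 : ω ∈ aliveSet X x N h n := by
        by_contra h3
        rcases returned_or_large h3 with ⟨_, j, i, hji, hin, hj, hi⟩ | ⟨_, i, hi, h4⟩
        · have h4 := returnTime_le h0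
            (mul_lt_mul_of_pos_right (by exact_mod_cast hji) hh) hj hi
          refine absurd h1 (not_lt.2 (h4.trans ?_))
          gcongr
        · have h5 : (i : ℝ≥0) * h ≤ (n + 1 : ℕ) * h := by
            gcongr; omega
          exact absurd (hN _ h5) (not_lt.2 h4)
      rw [Set.indicator_of_mem h2]
      refine (min_le_right _ _).trans ?_
      calc (((n + 1 : ℕ) * h : ℝ≥0) : ℝ≥0∞) = ((n * h : ℝ≥0) : ℝ≥0∞) + h := by
            push_cast; ring
        _ ≤ _ := by gcongr

variable [MeasurableSpace Ω] {P : ℕ → Measure Ω} {X : ℝ≥0 → Ω → ℕ} {α β : ℕ → ℝ}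

lemma IsCTMC.measurable_gridTime {Q : Matrix ℕ ℕ ℝ} (hX : IsCTMC Q P X) (x N : ℕ) (h : ℝ≥0)
    (n : ℕ) : Measurable (gridTime X x N h n) :=
  Finset.measurable_fun_sum _ fun i _ =>
    measurable_const.indicator (hX.measurableSet_aliveSet x N h i)

lemma IsCTMC.lintegral_gridTime {Q : Matrix ℕ ℕ ℝ} (hX : IsCTMC Q P X) (x N : ℕ) (h : ℝ≥0)
    (n : ℕ) : ∫⁻ ω, gridTime X x N h n ω ∂(P x) =
      ENNReal.ofReal (h * ∑ i ∈ Finset.range n, (P x).real (aliveSet X x N h i)) := by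
  have := hX.isProbabilityMeasure x
  simp only [gridTime]
  rw [lintegral_finsetSum _ fun i _ =>
    measurable_const.indicator (hX.measurableSet_aliveSet x N h i), Finset.mul_sum,
    ENNReal.ofReal_sum_of_nonneg fun i _ => mul_nonneg (NNReal.coe_nonneg h) measureReal_nonneg]
  refine Finset.sum_congr rfl fun i _ => ?_
  rw [lintegral_indicator_const (hX.measurableSet_aliveSet x N h i),
    ENNReal.ofReal_mul (NNReal.coe_nonneg h), ENNReal.ofReal_coe_nnreal, ofReal_measureReal]

/-- With G = ∑ c the potential is nonnegative, so Dynkin bounds the mean time by twice the initial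
value a, uniformly in N, h and n. -/
theorem IsCTMC.lintegral_returnTime_zero_lt_top (hX : IsCTMC (birthDeathMatrix α β) P X)
    (hα : ∀ n, 0 < α (n + 1)) (hβ : ∀ n, 0 < β n) (hc : Summable (speedWeight α β)) :
    ∫⁻ ω, returnTime X 0 ω ∂(P 0) < ∞ := by
  have := hX.isProbabilityMeasure 0
  set G := ∑' i, speedWeight α β i with hG
  set F := potential α β G with hF
  have hF0 : ∀ y, 0 ≤ F y := fun y => by
    refine Finset.sum_nonneg fun i _ => mul_nonneg (scaleWeight_pos hα hβ i).le ?_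
    exact sub_nonneg.2 (hc.sum_le_tsum _ fun i _ => (speedWeight_pos hα hβ i).le)
  have hβ0 := hβ 0
  -- Chosen so that β 0 * (F 1 - a) = -1: the mean holding time at 0 plus the potential at 1.
  set a := F 1 + 1 / β 0 with ha
  have ha0 : 0 ≤ a := add_nonneg (hF0 _) (by positivity)
  have hgen : ∀ y, y ≠ 0 → generator α β F y ≤ -1 := by
    intro y hy
    obtain ⟨y, rfl⟩ := Nat.exists_eq_succ_of_ne_zero hy
    exact (generator_potential hα hβ G y).le
  have hgenx : generator α β (Function.update F 0 a) 0 ≤ -1 := by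
    rw [generator_update, ha]
    simp only [if_true]
    field_simp
    linarith
  have hbound : ∀ N, 0 < N → ∀ᶠ h : ℝ≥0 in 𝓝[>] 0, ∀ n,
      ∫⁻ ω, gridTime X 0 N h n ω ∂(P 0) ≤ ENNReal.ofReal (2 * a) := by
    intro N hN
    filter_upwards [hX.eventually_integral_value_min_le hN (fun y _ hy => hgen y hy) hgenx
      (ε := 1 / 2) (by norm_num)] with h hh n
    rw [hX.lintegral_gridTime]
    refine ENNReal.ofReal_le_ofReal ?_
    have h1 : 0 ≤ ∫ ω, value a (fun z => F (min z N)) (gridTrack X 0 N h n ω) ∂(P 0) := by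
      refine integral_nonneg fun ω => ?_
      simp only [value]
      split_ifs
      exacts [hF0 _, ha0]
    linarith [hh n]
  have hchoice : ∀ t k : ℕ, ∃ n : ℕ, 0 < n ∧
      ∫⁻ ω, gridTime X 0 (k + 1) ((t + 1 : ℕ) / n) n ω ∂(P 0) ≤ ENNReal.ofReal (2 * a) := by
    intro t k
    have ht : (0 : ℝ≥0) < (t + 1 : ℕ) := by positivity
    obtain ⟨n, hn, hn0⟩ := (((tendsto_div_nat ht).eventually (hbound (k + 1) (by omega))).and
      (eventually_gt_atTop 0)).exists
    exact ⟨n, hn0, hn n⟩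
  choose ν hν0 hν using hchoice
  -- A measurable bound, almost surely above the return time capped at t + 1, got by raising the
  -- barrier k + 1. Fatou is applied once in k and once in t.
  set R : ℕ → Ω → ℝ≥0∞ := fun t ω =>
    liminf (fun k => gridTime X 0 (k + 1) ((t + 1 : ℕ) / ν t k) (ν t k) ω) atTop with hR
  have hRm : ∀ t, Measurable (R t) := fun t =>
    Measurable.liminf fun k => hX.measurable_gridTime _ _ _ _
  have hRint : ∀ t, ∫⁻ ω, R t ω ∂(P 0) ≤ ENNReal.ofReal (2 * a) := fun t =>
    (lintegral_liminf_le fun k => hX.measurable_gridTime _ _ _ _).trans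
      (liminf_le_of_le (by isBoundedDefault) fun b hb => by
        obtain ⟨k, hk⟩ := hb.exists
        exact hk.trans (hν t k))
  have hRle : ∀ᵐ ω ∂(P 0), ∀ t : ℕ, min (returnTime X 0 ω) ((t + 1 : ℕ) : ℝ≥0∞) ≤ R t ω := by
    filter_upwards [hX.ae_start 0, hX.nonexplosive 0] with ω h0 hexp t
    obtain ⟨N, hN⟩ := exists_bound_of_tendsto_jumpTime hexp (t + 1 : ℕ)
    refine le_liminf_of_le (by isBoundedDefault) ?_
    filter_upwards [eventually_ge_atTop N] with k hk
    have hn : (0 : ℝ≥0) < ν t k := by exact_mod_cast hν0 t k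
    have h1 : (ν t k : ℝ≥0) * ((t + 1 : ℕ) / ν t k) = (t + 1 : ℕ) := mul_div_cancel₀ _ hn.ne'
    have h2 := min_le_gridTime (N := k + 1) h0 (h := (t + 1 : ℕ) / ν t k)
      (div_pos (by positivity) hn) (ν t k) (fun s hs => by
        rw [h1] at hs
        exact (hN s hs).trans_le (by omega))
    rw [h1] at h2
    simpa using h2
  have hfin : ∫⁻ ω, returnTime X 0 ω ∂(P 0) ≤ ENNReal.ofReal (2 * a) := by
    calc ∫⁻ ω, returnTime X 0 ω ∂(P 0) ≤ ∫⁻ ω, liminf (fun t => R t ω) atTop ∂(P 0) := by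
          refine lintegral_mono_ae ?_
          filter_upwards [hRle] with ω hω
          have h1 : Tendsto (fun t : ℕ => min (returnTime X 0 ω) ((t + 1 : ℕ) : ℝ≥0∞)) atTop
              (𝓝 (min (returnTime X 0 ω) ∞)) :=
            tendsto_const_nhds.min
              ((tendsto_add_atTop_iff_nat 1).2 ENNReal.tendsto_nat_nhds_top)
          rw [min_eq_left le_top] at h1
          rw [← h1.liminf_eq]
          exact liminf_le_liminf (Eventually.of_forall hω)
      _ ≤ liminf (fun t => ∫⁻ ω, R t ω ∂(P 0)) atTop := lintegral_liminf_le hRm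
      _ ≤ _ := liminf_le_of_le (by isBoundedDefault) fun b hb => by
        obtain ⟨t, ht⟩ := hb.exists
        exact ht.trans (hRint t)
  exact hfin.trans_lt ENNReal.ofReal_lt_top

/-- Once the partial sums of c exceed G + 1, the increments are at most -w_i, and ∑ w diverges. -/
lemma tendsto_potential_atBot (hα : ∀ n, 0 < α (n + 1)) (hβ : ∀ n, 0 < β n)
    (hw : ¬ Summable (scaleWeight α β)) (hc : ¬ Summable (speedWeight α β)) (G : ℝ) :
    Tendsto (potential α β G) atTop atBot := by
  have h1 := (not_summable_iff_tendsto_nat_atTop_of_nonneg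
    fun n => (scaleWeight_pos hα hβ n).le).1 hw
  have h2 := (not_summable_iff_tendsto_nat_atTop_of_nonneg
    fun n => (speedWeight_pos hα hβ n).le).1 hc
  obtain ⟨M, hM⟩ := eventually_atTop.1
    (((tendsto_add_atTop_iff_nat 1).2 h2).eventually_ge_atTop (G + 1))
  have h3 : ∀ y, M ≤ y → potential α β G y ≤ (potential α β G M +
      ∑ i ∈ Finset.range M, scaleWeight α β i) - ∑ i ∈ Finset.range y, scaleWeight α β i := by
    intro y hy
    induction y, hy using Nat.le_induction with
    | base => simp
    | succ y hy ih =>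
      rw [Finset.sum_range_succ, potential, Finset.sum_range_succ, ← potential]
      have h4 := hM y hy
      have h5 := scaleWeight_pos hα hβ y
      nlinarith
  refine tendsto_atBot_mono' _ (eventually_atTop.2 ⟨M, h3⟩) ?_
  simp_rw [sub_eq_add_neg]
  exact tendsto_atBot_add_const_left _ _ (tendsto_neg_atTop_atBot.comp h1)

/-- F starts from mean -a and has generator at most 1 off x; it is 0 on return and nonnegative at N.
Climbing from -a to 0 takes time of order a, and a is arbitrary. -/
lemma IsCTMC.le_lintegral_returnTime (hX : IsCTMC (birthDeathMatrix α β) P X)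
    (hα : ∀ n, 0 < α (n + 1)) (hβ : ∀ n, 0 < β n)
    (hw : ¬ Summable (scaleWeight α β)) (hc : ¬ Summable (speedWeight α β)) (x : ℕ) (a : ℝ) :
    ENNReal.ofReal ((a - 1) / 2) ≤ ∫⁻ ω, returnTime X x ω ∂(P x) := by
  have := hX.isProbabilityMeasure x
  set q := β x + if x = 0 then 0 else α x with hq
  have hβx := hβ x
  have hwx := scaleWeight_pos hα hβ x
  -- Solved from β x * F (x + 1) = -(q * a), so that the generator at x with value -a is exactly 0.
  set G := ∑ j ∈ Finset.range (x + 1), speedWeight α β j + q * a / (β x * scaleWeight α β x)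
    with hG
  set F : ℕ → ℝ := fun y => potential α β G x + - potential α β G (max y x) with hF
  have hFx : F x = 0 := by simp [hF]
  have hgen : ∀ y, y ≠ x → generator α β F y ≤ 1 := by
    intro y hy
    rw [hF, generator_const_add, generator_neg]
    rcases lt_or_gt_of_ne hy with h | h
    · rw [generator_max_of_lt h]; norm_num
    · rw [generator_max h]
      obtain ⟨y, rfl⟩ := Nat.exists_eq_succ_of_ne_zero (Nat.ne_zero_of_lt h)
      rw [generator_potential hα hβ G y, neg_neg]
  have hgenx : generator α β (Function.update F x (-a)) x ≤ 1 := by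
    have h1 : F (x + 1) = - (scaleWeight α β x * (q * a / (β x * scaleWeight α β x))) := by
      simp only [hF]
      rw [max_eq_left (by omega)]
      simp only [potential]
      rw [Finset.sum_range_succ _ x, hG]
      ring
    have h2 : F (x - 1) = 0 := by
      simp only [hF]
      rw [max_eq_right (by omega)]
      ring
    have h3 : β x * F (x + 1) = - (q * a) := by
      rw [h1]; field_simp
    rw [generator_update, ← hq, h2, h3]
    linarith
  obtain ⟨N, hFN, hN⟩ := ((((tendsto_potential_atBot hα hβ hw hc G).eventually_le_atBot
    (potential α β G x))).and (eventually_gt_atTop x)).exists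
  have hFN : 0 ≤ F N := by
    simp only [hF]
    rw [max_eq_left hN.le]
    linarith
  obtain ⟨C, hC0, hC⟩ := hX.exists_exitTime_le hα hβ hN
  obtain ⟨B, hB⟩ := exists_bound_of_eventually_const (g := fun z => F (min z N)) (N := N)
    fun z hz => by simp [hz]
  set M := max B |a| with hM
  have hM0 : 0 ≤ M := (abs_nonneg a).trans (le_max_right _ _)
  -- Survival to time t has probability at most C / t, so paths still alive lower the mean of F by
  -- at most 1.
  obtain ⟨t, ht⟩ := exists_nat_gt (M * C)
  have ht0' : (0 : ℝ) < t := lt_of_le_of_lt (mul_nonneg hM0 hC0) ht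
  have ht0 : (0 : ℝ≥0) < t := by exact_mod_cast ht0'
  have hlow : ∀ᶠ n : ℕ in atTop, ENNReal.ofReal ((a - 1) / 2) ≤
      ∫⁻ ω, gridTime X x N (t / n) n ω ∂(P x) := by
    filter_upwards [(tendsto_div_nat ht0).eventually hC, (tendsto_div_nat ht0).eventually
      (hX.eventually_integral_value_min_le hN (fun y _ hy => hgen y hy) hgenx one_pos),
      eventually_gt_atTop 0] with n hn1 hn2 hn0
    rw [hX.lintegral_gridTime]
    refine ENNReal.ofReal_le_ofReal ?_
    have h1 := hn2 n
    have hn0' : (0 : ℝ) < n := by exact_mod_cast hn0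
    have h2 : t * (P x).real (aliveSet X x N (t / n) n) ≤ C := by
      have h3 := (hX.nat_mul_measure_aliveSet_le x N (t / n) n).trans (hn1 n)
      have h4 : (n : ℝ) * ((t / n : ℝ≥0) : ℝ) = t := by push_cast; field_simp
      rwa [h4] at h3
    have h5 : - M * (P x).real (aliveSet X x N (t / n) n) ≤
        ∫ ω, value (-a) (fun z => F (min z N)) (gridTrack X x N (t / n) n ω) ∂(P x) := by
      have hAm := hX.measurableSet_aliveSet x N (t / n) n
      have h6 : ∫ ω, (aliveSet X x N (t / n) n).indicator (fun _ => -M) ω ∂(P x) =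
          -M * (P x).real (aliveSet X x N (t / n) n) := by
        rw [integral_indicator_const _ hAm, smul_eq_mul, mul_comm]
      rw [← h6]
      refine integral_mono ((integrable_const _).indicator hAm)
        (hX.integrable_value_min (-a) F N x _ n) fun ω => ?_
      by_cases hω : ω ∈ aliveSet X x N (t / n) n
      · rw [Set.indicator_of_mem hω]
        simp only [value]
        split_ifs
        · exact (neg_le_neg (le_max_left _ _)).trans (neg_le_of_abs_le (hB _))
        · exact neg_le_neg ((le_abs_self a).trans (le_max_right _ _))
      · rw [Set.indicator_of_notMem hω]
        rcases returned_or_large hω with ⟨h7, _⟩ | ⟨h7, _⟩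
        · have h7 : gridTrack X x N (t / n) n ω = (true, x) := h7
          simp [value, h7, hN.le, hFx]
        · have h7 : N ≤ (gridTrack X x N (t / n) n ω).2 := h7
          have h8 : (gridTrack X x N (t / n) n ω).1 = true := track_fst_of_snd_ne (by
            change (gridTrack X x N (t / n) n ω).2 ≠ x
            omega)
          simpa [value, h8, h7] using hFN
    have h9 : M * (P x).real (aliveSet X x N (t / n) n) ≤ 1 := by
      have h10 := mul_le_mul_of_nonneg_left h2 hM0
      by_contra h11
      nlinarith
    linarith
  -- Reverse Fatou along finer grids on [0, t], with dominating constant t. The limsup is at most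
  -- the return time because fine grids detect the return before any later T.
  calc ENNReal.ofReal ((a - 1) / 2)
      ≤ limsup (fun n : ℕ => ∫⁻ ω, gridTime X x N (t / n) n ω ∂(P x)) atTop :=
        le_limsup_of_frequently_le hlow.frequently (by isBoundedDefault)
    _ ≤ ∫⁻ ω, limsup (fun n : ℕ => gridTime X x N (t / n) n ω) atTop ∂(P x) := by
        refine limsup_lintegral_le (fun _ => ((t : ℝ≥0) : ℝ≥0∞))
          (fun n => hX.measurable_gridTime _ _ _ _) (fun n => ae_of_all _ fun ω => ?_) (by simp)
        refine (gridTime_le X x N _ n ω).trans (ENNReal.coe_le_coe.2 ?_)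
        rcases Nat.eq_zero_or_pos n with rfl | hn
        · simp
        · rw [mul_div_cancel₀]
          exact_mod_cast hn.ne'
    _ ≤ ∫⁻ ω, returnTime X x ω ∂(P x) := by
        refine lintegral_mono_ae ?_
        filter_upwards [hX.ae_start x] with ω h0
        refine le_of_forall_gt_imp_ge_of_dense fun T hT => ?_
        obtain ⟨v, u, hvu, huT, hv, hu⟩ := exists_of_returnTime_lt h0 hT
        obtain ⟨w, huw, hwT⟩ := ENNReal.lt_iff_exists_nnreal_btwn.1 huT
        obtain ⟨b, hbw, -, hgrid⟩ := grid_return (hX.right_continuous ω) hvu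
          (ENNReal.coe_lt_coe.1 huw) hv hu
        refine limsup_le_of_le (by isBoundedDefault) ?_
        filter_upwards [(tendsto_div_nat ht0).eventually hgrid] with n ⟨j, i, hji, hib, hj, hi⟩
        have h1 : ω ∉ aliveSet X x N (t / n) i := not_alive_of_returned hji le_rfl hj hi
        refine (gridTime_le_of_not_alive h1 n).trans (le_trans ?_ hwT.le)
        exact ENNReal.coe_le_coe.2 (hib.le.trans hbw)

theorem IsCTMC.lintegral_returnTime_eq_top (hX : IsCTMC (birthDeathMatrix α β) P X)
    (hα : ∀ n, 0 < α (n + 1)) (hβ : ∀ n, 0 < β n)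
    (hw : ¬ Summable (scaleWeight α β)) (hc : ¬ Summable (speedWeight α β)) (x : ℕ) :
    ∫⁻ ω, returnTime X x ω ∂(P x) = ∞ := by
  refine ENNReal.eq_top_of_forall_nnreal_le fun r => ?_
  have h := hX.le_lintegral_returnTime hα hβ hw hc x (2 * r + 1)
  rwa [show ((2 * (r : ℝ) + 1 - 1) / 2) = r by ring, ENNReal.ofReal_coe_nnreal] at h

end CTMC

/-! ### Series with affine ratios -/

lemma tendsto_affine_div_affine (A p q : ℝ) {B : ℝ} (hB : B ≠ 0) :
    Tendsto (fun n : ℕ => (A * (n + 1) + p) / (B * (n + 1) + q)) atTop (𝓝 (A / B)) := by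
  have h1 : Tendsto (fun n : ℕ => ((n : ℝ) + 1)⁻¹) atTop (𝓝 0) :=
    tendsto_inv_atTop_zero.comp (tendsto_atTop_add_const_right _ _ tendsto_natCast_atTop_atTop)
  have h2 : Tendsto (fun n : ℕ => (A + p * ((n : ℝ) + 1)⁻¹) / (B + q * ((n : ℝ) + 1)⁻¹)) atTop
      (𝓝 ((A + p * 0) / (B + q * 0))) :=
    ((h1.const_mul p).const_add A).div ((h1.const_mul q).const_add B) (by simpa using hB)
  simp only [mul_zero, add_zero] at h2
  refine h2.congr fun n => ?_
  have h3 : (n : ℝ) + 1 ≠ 0 := by positivity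
  rw [← mul_div_mul_right _ _ h3]
  congr 1 <;> field_simp

section

variable {u : ℕ → ℝ} {A B p q : ℝ}

lemma summable_of_affine_ratio_lt (hu : ∀ n, 0 < u n) (hA : 0 < A) (hAB : A < B)
    (h : ∀ n : ℕ, u (n + 1) / u n = (A * (n + 1) + p) / (B * (n + 1) + q)) : Summable u := by
  refine summable_of_ratio_test_tendsto_lt_one (l := A / B) ?_
    (Eventually.of_forall fun n => (hu n).ne') ?_
  · rw [div_lt_one (hA.trans hAB)]; exact hAB
  · refine (tendsto_affine_div_affine A p q (hA.trans hAB).ne').congr fun n => ?_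
    rw [← h n, Real.norm_of_nonneg (hu _).le, Real.norm_of_nonneg (hu _).le]

lemma not_summable_of_affine_ratio_gt (hu : ∀ n, 0 < u n) (hB : 0 < B) (hAB : B < A)
    (h : ∀ n : ℕ, u (n + 1) / u n = (A * (n + 1) + p) / (B * (n + 1) + q)) : ¬ Summable u := by
  refine not_summable_of_ratio_test_tendsto_gt_one (l := A / B) ?_ ?_
  · rw [one_lt_div hB]; exact hAB
  · refine (tendsto_affine_div_affine A p q hB.ne').congr fun n => ?_
    rw [← h n, Real.norm_of_nonneg (hu _).le, Real.norm_of_nonneg (hu _).le]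

/-- Raabe's criterion by telescoping: (q - p - A) u_n is the decrement of (A n + q) u_n, so partial
sums are at most q u_0 / (q - p - A). -/
lemma summable_of_affine_ratio (hu : ∀ n, 0 < u n) (hq : ∀ n : ℕ, 0 < A * (n + 1) + q)
    (hpq : A < q - p)
    (h : ∀ n : ℕ, u (n + 1) / u n = (A * (n + 1) + p) / (A * (n + 1) + q)) : Summable u := by
  have h1 : ∀ n : ℕ, (q - p - A) * u n = (A * n + q) * u n - (A * (n + 1) + q) * u (n + 1) := by
    intro n
    have h2 := h n
    rw [div_eq_div_iff (hu n).ne' (hq n).ne'] at h2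
    linear_combination h2
  have h3 : 0 < q - p - A := by linarith
  refine summable_of_sum_range_le (c := q * u 0 / (q - p - A)) (fun n => (hu n).le) fun n => ?_
  rw [le_div_iff₀ h3]
  have h4 : (∑ i ∈ Finset.range (n + 1), u i) * (q - p - A) =
      q * u 0 - (A * (n + 1) + q) * u (n + 1) := by
    rw [mul_comm, Finset.mul_sum]
    induction n with
    | zero => rw [Finset.sum_range_one, h1 0]; simp
    | succ n ih => rw [Finset.sum_range_succ, ih, h1 (n + 1)]; push_cast; ring
  rw [Finset.sum_range_succ] at h4
  have h5 := mul_pos (hq n) (hu (n + 1))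
  have h6 := mul_pos h3 (hu n)
  nlinarith

/-- Here (A (n+1) + q) u_(n+1) is nondecreasing, so u dominates a multiple of the harmonic series.
-/
lemma not_summable_of_affine_ratio (hu : ∀ n, 0 < u n) (_hA : 0 < A)
    (hq : ∀ n : ℕ, 0 < A * (n + 1) + q) (hpq : q - p ≤ A)
    (h : ∀ n : ℕ, u (n + 1) / u n = (A * (n + 1) + p) / (A * (n + 1) + q)) : ¬ Summable u := by
  have h1 : ∀ n : ℕ, (A * 1 + q) * u 1 ≤ (A * (n + 1) + q) * u (n + 1) := by
    intro n
    induction n with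
    | zero => simp
    | succ n ih =>
      refine ih.trans ?_
      have h2 := h (n + 1)
      rw [div_eq_div_iff (hu _).ne' (hq _).ne'] at h2
      have h3 := hu (n + 1)
      push_cast at h2 ⊢
      nlinarith
  have h0 : 0 < (A * 1 + q) * u 1 := mul_pos (by simpa using hq 0) (hu 1)
  intro hs
  have hs1 := (summable_nat_add_iff 1).2 hs
  have h4 : Summable fun n : ℕ => (1 : ℝ) / ((n + 1 : ℕ) : ℝ) := by
    refine Summable.of_nonneg_of_le (fun n => by positivity) (fun n => ?_)
      (hs1.mul_left ((A + |q|) / ((A * 1 + q) * u 1)))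
    rw [div_mul_eq_mul_div, div_le_div_iff₀ (by positivity) h0, one_mul]
    refine (h1 n).trans ?_
    have h5 := hu (n + 1)
    have h6 : A * (n + 1) + q ≤ (A + |q|) * (n + 1) := by
      have := le_abs_self q
      have h7 : 0 ≤ |q| * n := by positivity
      nlinarith
    push_cast
    calc (A * (n + 1) + q) * u (n + 1) ≤ ((A + |q|) * (n + 1)) * u (n + 1) :=
          mul_le_mul_of_nonneg_right h6 h5.le
      _ = _ := by ring
  exact Real.not_summable_one_div_natCast ((summable_nat_add_iff 1).1 h4)

end

/-! ### The linear growth model -/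

namespace CTMC

variable {k r m s : ℝ}

lemma scaleWeight_ratio (hk : 0 < k) (hr : 0 ≤ r) (hm : 0 < m) (hs : 0 < s) (n : ℕ) :
    scaleWeight (fun n => k * n + r) (fun n => m * n + s) (n + 1) /
      scaleWeight (fun n => k * n + r) (fun n => m * n + s) n =
      (k * (n + 1) + r) / (m * (n + 1) + s) := by
  have h := scaleWeight_pos (α := fun n => k * n + r) (β := fun n => m * n + s)
    (fun n => by positivity) (fun n => by positivity) n
  have h1 := mul_scaleWeight_succ (α := fun n => k * n + r) (β := fun n => m * n + s)
    (fun n => by positivity) n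
  rw [div_eq_div_iff h.ne' (by positivity)]
  push_cast at h1
  linear_combination h1

/-- The ratio is β_n / α_(n+1); its numerator m n + s is rewritten in n + 1 to fit the affine
criteria. For k = m the threshold becomes s - r < 0. -/
lemma speedWeight_ratio (hk : 0 < k) (hr : 0 ≤ r) (hm : 0 < m) (hs : 0 < s) (n : ℕ) :
    speedWeight (fun n => k * n + r) (fun n => m * n + s) (n + 1) /
      speedWeight (fun n => k * n + r) (fun n => m * n + s) n =
      (m * (n + 1) + (s - m)) / (k * (n + 1) + r) := by
  have h := scaleWeight_pos (α := fun n => k * n + r) (β := fun n => m * n + s)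
    (fun n => by positivity) (fun n => by positivity) n
  have h1 := mul_scaleWeight_succ (α := fun n => k * n + r) (β := fun n => m * n + s)
    (fun n => by positivity) n
  have h2 : 0 < m * n + s := by positivity
  have h3 : 0 < k * (n + 1) + r := by positivity
  simp only [speedWeight]
  rw [h1]
  push_cast
  field_simp
  ring

end CTMC

theorem mainTheorem6 {Ω : Type*} [MeasurableSpace Ω] (k r m s : ℝ)
    (hk : 0 < k) (hr : 0 ≤ r) (hm : 0 < m) (hs : 0 < s)
    (P : ℕ → Measure Ω) (X : ℝ≥0 → Ω → ℕ) (hX : CTMC.IsLinearGrowthModel k r m s P X) :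
    (CTMC.IsRecurrent P X ↔ (m < k ∨ (s - r ≤ k ∧ k = m))) ∧
    (CTMC.IsNullRecurrent P X ↔ (0 ≤ s - r ∧ s - r ≤ k ∧ k = m)) ∧
    (CTMC.IsTransient P X ↔ (k < m ∨ (k < s - r ∧ k = m))) := by
  have hα : ∀ n : ℕ, 0 < (fun n : ℕ => k * n + r) (n + 1) := fun n => by positivity
  have hβ : ∀ n : ℕ, 0 < (fun n : ℕ => m * n + s) n := fun n => by positivity
  set w := CTMC.scaleWeight (fun n : ℕ => k * n + r) (fun n => m * n + s) with hw
  set c := CTMC.speedWeight (fun n : ℕ => k * n + r) (fun n => m * n + s) with hc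
  have hw0 : ∀ n, 0 < w n := CTMC.scaleWeight_pos hα hβ
  have hc0 : ∀ n, 0 < c n := CTMC.speedWeight_pos hα hβ
  have hwr := CTMC.scaleWeight_ratio hk hr hm hs
  have hcr := CTMC.speedWeight_ratio hk hr hm hs
  have hrec : ¬ Summable w → CTMC.IsRecurrent P X := CTMC.IsCTMC.isRecurrent hX hα hβ
  have htrans : Summable w → CTMC.IsTransient P X := CTMC.IsCTMC.isTransient hX hα hβ
  have hexcl : CTMC.IsRecurrent P X → ¬ CTMC.IsTransient P X := fun h1 h2 =>
    absurd (h1 0) (h2 0).ne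
  have hw1 : (k < m ∨ (k < s - r ∧ k = m)) → Summable w := by
    rintro (h | ⟨h, rfl⟩)
    · exact summable_of_affine_ratio_lt hw0 hk h hwr
    · exact summable_of_affine_ratio hw0 (fun n => by positivity) h hwr
  have hw2 : (m < k ∨ (s - r ≤ k ∧ k = m)) → ¬ Summable w := by
    rintro (h | ⟨h, rfl⟩)
    · exact not_summable_of_affine_ratio_gt hw0 hm h hwr
    · exact not_summable_of_affine_ratio hw0 hk (fun n => by positivity) h hwr
  have hc1 : (m < k ∨ (s - r < 0 ∧ k = m)) → Summable c := by
    rintro (h | ⟨h, rfl⟩)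
    · exact summable_of_affine_ratio_lt hc0 hm h hcr
    · exact summable_of_affine_ratio hc0 (fun n => by positivity) (by linarith) hcr
  have hc2 : (0 ≤ s - r ∧ k = m) → ¬ Summable c := by
    rintro ⟨h, rfl⟩
    exact not_summable_of_affine_ratio hc0 hk (fun n => by positivity) (by linarith) hcr
  -- The two parameter regions are exhaustive and recurrence excludes transience, so the one-way
  -- criteria become equivalences.
  have hcases : (m < k ∨ (s - r ≤ k ∧ k = m)) ∨ (k < m ∨ (k < s - r ∧ k = m)) := by
    rcases lt_trichotomy k m with h | h | h
    · exact Or.inr (Or.inl h)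
    · rcases le_or_gt (s - r) k with h' | h'
      · exact Or.inl (Or.inr ⟨h', h⟩)
      · exact Or.inr (Or.inr ⟨h', h⟩)
    · exact Or.inl (Or.inl h)
  have hrec_iff : CTMC.IsRecurrent P X ↔ (m < k ∨ (s - r ≤ k ∧ k = m)) :=
    ⟨fun h => hcases.resolve_right fun h' => hexcl h (htrans (hw1 h')), fun h => hrec (hw2 h)⟩
  refine ⟨hrec_iff, ⟨?_, ?_⟩, ⟨fun h => hcases.resolve_left fun h' => hexcl (hrec (hw2 h')) h,
    fun h => htrans (hw1 h)⟩⟩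
  · rintro ⟨h1, h2⟩
    -- State 0 alone suffices: null recurrence requires an infinite mean return time at every state.
    have h3 : ¬ Summable c := fun h4 =>
      (CTMC.IsCTMC.lintegral_returnTime_zero_lt_top hX hα hβ h4).ne (h2 0)
    rcases hrec_iff.1 h1 with h4 | ⟨h4, h5⟩
    · exact absurd (hc1 (Or.inl h4)) h3
    · exact ⟨not_lt.1 fun h6 => h3 (hc1 (Or.inr ⟨h6, h5⟩)), h4, h5⟩
  · rintro ⟨h1, h2, h3⟩
    exact ⟨hrec_iff.2 (Or.inr ⟨h2, h3⟩), CTMC.IsCTMC.lintegral_returnTime_eq_top hX hα hβ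
      (hw2 (Or.inr ⟨h2, h3⟩)) (hc2 ⟨h1, h3⟩)⟩
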